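/- Fix $N\ge 2$ parties. All systems are finite-dimensional; a system $S$ consists of one local Hilbert space per party, and states are density operators on the tensor product of the local spaces. An LOCC protocol has finitely many rounds; in each round the parties perform local measurements with finitely many outcomes (given by Kraus operators) and announce the outcomes, on which everything that follows may depend. $\|M\|_1=\mathrm{Tr}\sqrt{M^\dagger M}$ is the trace norm. Let $\rho$ be a state of a system $S$ and $\sigma$ a state of a system $S'$ (for instance $S'=S$) shared by the $N$ parties. * $\rho$ is *reducible onto $\sigma$ in the marginals* if for all $\varepsilon,\delta>0$ there are integers $0\le m\le n$, $n\ge 1$, and an LOCC protocol $\Lambda$ taking $\rho^{\otimes n}$ to a state $\mu_m=\Lambda(\rho^{\otimes n})$ of $m$ copies of $S'$ such that $\|\mu_m^{(i)}-\sigma\|_1<\varepsilon$ for every $i\le m$, where $\mu_m^{(i)}$ is the reduced state on the $i$-th copy, and $\frac mn+\delta>1$. * $\rho$ *can be converted into $\sigma$ via correlated catalysis* if for every $\varepsilon>0$ there are a system $C$ shared by the parties, a state $\tau$ of $C$ and an LOCC protocol $\Lambda$ from $SC$ to $S'C$ such that $\mu=\Lambda(\rho\otimes\tau)$ satisfies $\|\mathrm{Tr}_C\,\mu-\sigma\|_1<\varepsilon$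 and $\mathrm{Tr}_{S'}\,\mu=\tau$. * Let $\Phi_N=\bigotimes_{p<q}|\psi^-\rangle\langle\psi^-|_{pq}$ be the state consisting of one singlet $|\psi^-\rangle=(|01\rangle-|10\rangle)/\sqrt2$ for each pair of parties (each party holds one qubit for every other party; for $N=2$ this is one singlet). The state $\rho$ is *distillable* if there is $r>0$ such that for all $\varepsilon,\delta>0$ there are integers $m\ge 0$, $n\ge1$ and an LOCC protocol $\Lambda$ with $\|\Lambda(\rho^{\otimes n})-\Phi_N^{\otimes m}\|_1<\varepsilon$ and $\frac mn+\delta>r$. **Theorem.** If $\rho$ and $\sigma$ are distillable, then $\rho$ is reducible onto $\sigma$ in the marginals if and only if $\rho$ can be converted into $\sigma$ via correlated catalysis. Moreover, for arbitrary states $\rho$ and $\sigma$, marginal reducibility of $\rho$ onto $\sigma$ implies convertibility of $\rho$ into $\sigma$ via correlated catalysis; and the converse implication holds whenever $\rho$ is distillable (with $\sigma$ arbitrary). -/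

import Mathlib

open scoped Matrix ComplexOrder

namespace QEnt

/-- Operators on the joint Hilbert space `⨂ p, ℂ ^ (d p)` of `N` parties, `ℂ ^ (d p)` being the
space of party `p` with basis `d p`: the product basis is indexed by the tuples `∀ p, d p`. -/
abbrev Op {N : ℕ} (d : Fin N → Type) : Type := Matrix (∀ p, d p) (∀ p, d p) ℂ

/-- A quantum state (density operator). -/
def IsState {ι : Type} [Fintype ι] (ρ : Matrix ι ι ℂ) : Prop := ρ.PosSemidef ∧ ρ.trace = 1

open scoped MatrixOrder in
/-- The trace norm `Tr √(M† M)`. -/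
noncomputable def traceNorm {ι : Type} [Fintype ι] [DecidableEq ι] (M : Matrix ι ι ℂ) : ℝ :=
  (CFC.sqrt (Mᴴ * M)).trace.re

/-- The tensor product `⨂ p, A p` of local operators. -/
def localProd {N : ℕ} {d e : Fin N → Type} (A : ∀ p, Matrix (e p) (d p) ℂ) :
    Matrix (∀ p, e p) (∀ p, d p) ℂ :=
  Matrix.of fun y x => ∏ p, A p (y p) (x p)

/-- Channels implementable by local operations and classical communication, with finitely many
rounds. In one round every party `p` performs a local measurement with finitely many outcomes
`j : κ p` and Kraus operators `A p j`, where `∑ j, (A p j)† (A p j) = 1`, and announces the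
outcome to all parties. The protocol then continues with a protocol `Λ k` that depends on the
tuple `k` of all the announced outcomes. The space of a party after its measurement may differ
from the one before, and may depend on the party's outcome. A party that only waits uses
the identity as its single Kraus operator; a local channel is a measurement whose outcome is
ignored afterwards (in particular, parties may discard subsystems and append local ancillas). -/
inductive IsLOCC {N : ℕ} {e : Fin N → Type} [∀ p, Fintype (e p)] [∀ p, DecidableEq (e p)] :
    {d : Fin N → Type} → [∀ p, Fintype (d p)] → [∀ p, DecidableEq (d p)] →
    (Op d → Op e) → Prop
  | done : IsLOCC (fun X : Op e => X)
  | round {d : Fin N → Type} [∀ p, Fintype (d p)] [∀ p, DecidableEq (d p)]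
      (κ : Fin N → Type) [∀ p, Fintype (κ p)]
      (d' : ∀ p, κ p → Type) [∀ p j, Fintype (d' p j)] [∀ p j, DecidableEq (d' p j)]
      (A : ∀ p j, Matrix (d' p j) (d p) ℂ) (hA : ∀ p, ∑ j, (A p j)ᴴ * A p j = 1)
      (Λ : ∀ k : (∀ p, κ p), Op (fun p => d' p (k p)) → Op e) (hΛ : ∀ k, IsLOCC (Λ k)) :
      IsLOCC (fun X : Op d => ∑ k : (∀ p, κ p),
        Λ k (localProd (fun p => A p (k p)) * X * (localProd (fun p => A p (k p)))ᴴ))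

/-- The local spaces of `n` copies of a system with local spaces `ℂ ^ (d p)`. -/
abbrev Copies {N : ℕ} (d : Fin N → Type) (n : ℕ) : Fin N → Type := fun p => Fin n → d p

/-- `ρ^{⊗ n}`. -/
def power {N : ℕ} {d : Fin N → Type} (ρ : Op d) (n : ℕ) : Op (Copies d n) :=
  Matrix.of fun x y => ∏ i, ρ (fun p => x p i) (fun p => y p i)

/-- The marginal of an `m`-copy operator on the `i`-th copy (all other copies are traced out). -/
def copyMarginal {N : ℕ} {d : Fin N → Type} [∀ p, Fintype (d p)] [∀ p, DecidableEq (d p)]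
    {m : ℕ} (i : Fin m) (μ : Op (Copies d m)) : Op d :=
  Matrix.of fun x y => ∑ u : (∀ p, Fin m → d p) with (fun p => u p i) = x,
    μ u (fun p => Function.update (u p) i (y p))

/-- The local spaces of the system `S C`: each party holds a part of `S` and a part of `C`. -/
abbrev Joint {N : ℕ} (d c : Fin N → Type) : Fin N → Type := fun p => d p × c p

/-- `ρ^S ⊗ τ^C`. -/
def tensor {N : ℕ} {d c : Fin N → Type} (ρ : Op d) (τ : Op c) : Op (Joint d c) :=
  Matrix.of fun x y =>
    ρ (fun p => (x p).1) (fun p => (y p).1) * τ (fun p => (x p).2) (fun p => (y p).2)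

/-- `μ^S = Tr_C μ^{SC}`. -/
def marginalS {N : ℕ} {d c : Fin N → Type} [∀ p, Fintype (c p)] (μ : Op (Joint d c)) : Op d :=
  Matrix.of fun x y => ∑ z : (∀ p, c p), μ (fun p => (x p, z p)) (fun p => (y p, z p))

/-- `μ^C = Tr_S μ^{SC}`. -/
def marginalC {N : ℕ} {d c : Fin N → Type} [∀ p, Fintype (d p)] (μ : Op (Joint d c)) : Op c :=
  Matrix.of fun z w => ∑ x : (∀ p, d p), μ (fun p => (x p, z p)) (fun p => (x p, w p))

section Tasks

variable {N : ℕ} {d e : Fin N → Type} [∀ p, Fintype (d p)] [∀ p, DecidableEq (d p)]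
  [∀ p, Fintype (e p)] [∀ p, DecidableEq (e p)]

/-- `ρ` is reducible onto `σ` in the marginals. -/
def MarginallyReducible (ρ : Op d) (σ : Op e) : Prop :=
  ∀ ε : ℝ, 0 < ε → ∀ δ : ℝ, 0 < δ → ∃ m n : ℕ, 0 < n ∧ m ≤ n ∧
    ∃ Λ : Op (Copies d n) → Op (Copies e m), IsLOCC Λ ∧
      (∀ i : Fin m, traceNorm (copyMarginal i (Λ (power ρ n)) - σ) < ε) ∧
      1 < (m : ℝ) / n + δ

/-- `ρ` can be converted into `σ` via correlated catalysis. -/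
def CatalyticallyConvertible (ρ : Op d) (σ : Op e) : Prop :=
  ∀ ε : ℝ, 0 < ε → ∃ (c : Fin N → Type) (_ : ∀ p, Fintype (c p)) (_ : ∀ p, DecidableEq (c p))
    (τ : Op c) (Λ : Op (Joint d c) → Op (Joint e c)), IsState τ ∧ IsLOCC Λ ∧
      traceNorm (marginalS (Λ (tensor ρ τ)) - σ) < ε ∧
      marginalC (Λ (tensor ρ τ)) = τ

/-- `ρ` can be transformed asymptotically into `σ` at rate `r`. -/
def AchievableRate (ρ : Op d) (σ : Op e) (r : ℝ) : Prop :=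
  ∀ ε : ℝ, 0 < ε → ∀ δ : ℝ, 0 < δ → ∃ m n : ℕ, 0 < n ∧
    ∃ Λ : Op (Copies d n) → Op (Copies e m), IsLOCC Λ ∧
      traceNorm (Λ (power ρ n) - power σ m) < ε ∧
      r < (m : ℝ) / n + δ

end Tasks

/-- The coefficients of the singlet `(|01⟩ - |10⟩) / √2`. -/
noncomputable def singlet (a b : Fin 2) : ℂ :=
  !![0, 1 / (√2 : ℝ); -1 / (√2 : ℝ), 0] a b

/-- Local spaces carrying a singlet between each pair of parties: party `p` holds one qubit for
every other party `q`. -/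
abbrev PairQubits (N : ℕ) : Fin N → Type := fun p => {q : Fin N // q ≠ p} → Fin 2

/-- The state `⨂_{p < q} |ψ⁻⟩⟨ψ⁻|_{pq}` consisting of one singlet for each pair of parties. -/
noncomputable def pairSinglets (N : ℕ) : Op (PairQubits N) :=
  let φ : (∀ p, PairQubits N p) → ℂ := fun x =>
    ∏ pq : {pq : Fin N × Fin N // pq.1 < pq.2},
      singlet (x pq.1.1 ⟨pq.1.2, pq.2.ne'⟩) (x pq.1.2 ⟨pq.1.1, pq.2.ne⟩)
  Matrix.vecMulVec φ (star φ)

/-- `ρ` is distillable: singlets between all pairs of parties can be obtained at nonzero rate. -/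
def Distillable {N : ℕ} {d : Fin N → Type} [∀ p, Fintype (d p)] [∀ p, DecidableEq (d p)]
    (ρ : Op d) : Prop :=
  ∃ r : ℝ, 0 < r ∧ AchievableRate ρ (pairSinglets N) r

end QEnt

set_option linter.unusedSectionVars false

/-! From marginal reducibility to catalysis. Pad the protocol with a fixed product state so that it
takes n = L + 1 copies of ρ to n copies of S', in a state μ. The catalyst carries a public register
b, uniform on 0, …, L; given b it holds L - b copies of ρ together with the last b copies of μ. Each
use absorbs the incoming ρ. If b > 0, the first of the held copies of μ is released and b drops by
one; if b = 0, there are now n copies of ρ, the protocol turns them into μ, its first copy is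
released and b becomes L. The register is permuted cyclically and the conditional states follow it,
so the catalyst is restored exactly, while the output is the average of the n marginals of μ
(`exists_cyclic_catalyst`, `exists_catalyst_of_copies`). The released copy may be correlated with
the catalyst; this is harmless, since only marginals are constrained. Padding spoils only a small
fraction of the copies.

From catalysis to marginal reducibility, with ρ distillable. A fixed number of copies of ρ is spent
on preparing the catalyst τ approximately: distill finitely many singlets, then teleport
(`exists_prepare`, `Distillable.exists_approx`). The catalyst then serves t further copies of ρ in
succession. Its marginal returns exactly to τ after each use and the next copy of ρ is fresh, so
with the ideal τ every output has the marginal of a single catalytic conversion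
(`exists_iterate_catalysis`). The error in τ enters each marginal only once, because LOCC does not
increase the trace norm, and the preparation cost is negligible against t. -/

namespace QEnt

/-! ### Trace norm through positive decompositions -/

section TraceNorm

variable {ι : Type} [Fintype ι]

/-- `X` is a difference of positive semidefinite operators of total trace at most `b`. For
Hermitian `X` this says that the trace norm of `X` is at most `b`. -/
def TraceBound (b : ℝ) (X : Matrix ι ι ℂ) : Prop :=
  ∃ P Q : Matrix ι ι ℂ, P.PosSemidef ∧ Q.PosSemidef ∧ X = P - Q ∧ (P.trace + Q.trace).re ≤ b

theorem TraceBound.mono {b c : ℝ} {X : Matrix ι ι ℂ} (h : TraceBound b X) (hbc : b ≤ c) :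
    TraceBound c X := by
  obtain ⟨P, Q, hP, hQ, hX, hb⟩ := h
  exact ⟨P, Q, hP, hQ, hX, hb.trans hbc⟩

theorem TraceBound.zero : TraceBound 0 (0 : Matrix ι ι ℂ) :=
  ⟨0, 0, .zero, .zero, by simp, by simp⟩

theorem TraceBound.add {b c : ℝ} {X Y : Matrix ι ι ℂ} (hX : TraceBound b X)
    (hY : TraceBound c Y) : TraceBound (b + c) (X + Y) := by
  obtain ⟨P, Q, hP, hQ, rfl, hb⟩ := hX
  obtain ⟨R, S, hR, hS, rfl, hc⟩ := hY
  refine ⟨P + R, Q + S, hP.add hR, hQ.add hS, by abel, ?_⟩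
  simp only [Matrix.trace_add, Complex.add_re] at *
  linarith

theorem TraceBound.sum {κ : Type} (s : Finset κ) {b : κ → ℝ} {X : κ → Matrix ι ι ℂ}
    (h : ∀ k ∈ s, TraceBound (b k) (X k)) : TraceBound (∑ k ∈ s, b k) (∑ k ∈ s, X k) := by
  classical
  induction s using Finset.induction_on with
  | empty => simpa using TraceBound.zero
  | insert k s hk ih =>
    rw [Finset.sum_insert hk, Finset.sum_insert hk]
    exact (h k (by simp)).add (ih fun j hj => h j (by simp [hj]))

theorem TraceBound.smul {b : ℝ} {X : Matrix ι ι ℂ} (h : TraceBound b X) {t : ℝ} (ht : 0 ≤ t) :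
    TraceBound (t * b) ((t : ℂ) • X) := by
  obtain ⟨P, Q, hP, hQ, rfl, hb⟩ := h
  have ht' : (0 : ℂ) ≤ (t : ℂ) := by exact_mod_cast ht
  refine ⟨(t : ℂ) • P, (t : ℂ) • Q, hP.smul ht', hQ.smul ht', by rw [smul_sub], ?_⟩
  rw [Matrix.trace_smul, Matrix.trace_smul, ← smul_add, smul_eq_mul, Complex.re_ofReal_mul]
  exact mul_le_mul_of_nonneg_left hb ht

theorem TraceBound.sub_of_isState {X Y : Matrix ι ι ℂ} (hX : IsState X) (hY : IsState Y) :
    TraceBound 2 (X - Y) :=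
  ⟨X, Y, hX.1, hY.1, rfl, by rw [hX.2, hY.2]; norm_num⟩

theorem TraceBound.map {κ : Type} [Fintype κ] {b : ℝ} {X : Matrix ι ι ℂ} (h : TraceBound b X)
    {Λ : Matrix ι ι ℂ → Matrix κ κ ℂ} (hadd : ∀ X Y, Λ (X - Y) = Λ X - Λ Y)
    (hpos : ∀ X, X.PosSemidef → (Λ X).PosSemidef) (htr : ∀ X, (Λ X).trace = X.trace) :
    TraceBound b (Λ X) := by
  obtain ⟨P, Q, hP, hQ, rfl, hb⟩ := h
  exact ⟨Λ P, Λ Q, hpos P hP, hpos Q hQ, hadd P Q, by rw [htr, htr]; exact hb⟩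

variable [DecidableEq ι]

-- Uniqueness of the positive square root: the right-hand side is positive semidefinite and squares
-- to `Xᴴ * X`.
open scoped MatrixOrder in
theorem sqrt_conj_diagonal (U : Matrix.unitaryGroup ι ℂ) (a : ι → ℝ) {X : Matrix ι ι ℂ}
    (hX : X = (U : Matrix ι ι ℂ) * Matrix.diagonal (fun i => (a i : ℂ)) *
      (U : Matrix ι ι ℂ)ᴴ) :
    CFC.sqrt (Xᴴ * X) = (U : Matrix ι ι ℂ) * Matrix.diagonal (fun i => ((|a i| : ℝ) : ℂ)) *
      (U : Matrix ι ι ℂ)ᴴ := by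
  have hU : (U : Matrix ι ι ℂ)ᴴ * (U : Matrix ι ι ℂ) = 1 :=
    (Matrix.mem_unitaryGroup_iff').1 U.2
  have key : ∀ A B : Matrix ι ι ℂ, (U : Matrix ι ι ℂ) * A * (U : Matrix ι ι ℂ)ᴴ *
      ((U : Matrix ι ι ℂ) * B * (U : Matrix ι ι ℂ)ᴴ) =
      (U : Matrix ι ι ℂ) * (A * B) * (U : Matrix ι ι ℂ)ᴴ := fun A B => by
    simp only [Matrix.mul_assoc]
    rw [← Matrix.mul_assoc _ (U : Matrix ι ι ℂ) (B * _), hU, Matrix.one_mul]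
  refine CFC.sqrt_unique ?_ ?_
  · have : Xᴴ = X := by
      rw [hX]
      simp only [Matrix.conjTranspose_mul, Matrix.conjTranspose_conjTranspose,
        Matrix.diagonal_conjTranspose, Matrix.mul_assoc]
      congr
      funext i
      simp
    rw [this, hX, key, key, Matrix.diagonal_mul_diagonal, Matrix.diagonal_mul_diagonal]
    congr
    funext i
    norm_cast
    exact abs_mul_abs_self _
  · rw [Matrix.nonneg_iff_posSemidef]
    refine Matrix.PosSemidef.mul_mul_conjTranspose_same ?_ _
    rw [Matrix.posSemidef_diagonal_iff]
    intro i
    exact_mod_cast abs_nonneg _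

theorem exists_unitary_diagonal {X : Matrix ι ι ℂ} (hX : X.IsHermitian) :
    ∃ (U : Matrix.unitaryGroup ι ℂ) (a : ι → ℝ), X = (U : Matrix ι ι ℂ) *
      Matrix.diagonal (fun i => (a i : ℂ)) * (U : Matrix ι ι ℂ)ᴴ :=
  ⟨hX.eigenvectorUnitary, hX.eigenvalues, by
    conv_lhs => rw [hX.spectral_theorem]
    rfl⟩

theorem trace_conj_unitary (U : Matrix.unitaryGroup ι ℂ) (A : Matrix ι ι ℂ) :
    ((U : Matrix ι ι ℂ) * A * (U : Matrix ι ι ℂ)ᴴ).trace = A.trace := by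
  have hU : (U : Matrix ι ι ℂ)ᴴ * (U : Matrix ι ι ℂ) = 1 :=
    (Matrix.mem_unitaryGroup_iff').1 U.2
  rw [Matrix.trace_mul_comm, ← Matrix.mul_assoc, hU, Matrix.one_mul]

/-- Jordan decomposition: the positive and negative parts of the eigenvalues serve as `P` and `Q`.
-/
theorem TraceBound.of_traceNorm {X : Matrix ι ι ℂ} (hX : X.IsHermitian) :
    TraceBound (traceNorm X) X := by
  obtain ⟨U, a, h⟩ := exists_unitary_diagonal hX
  refine ⟨(U : Matrix ι ι ℂ) * Matrix.diagonal (fun i => (((a i)⁺ : ℝ) : ℂ)) * (U : Matrix ι ι ℂ)ᴴ,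
    (U : Matrix ι ι ℂ) * Matrix.diagonal (fun i => (((a i)⁻ : ℝ) : ℂ)) * (U : Matrix ι ι ℂ)ᴴ,
    ?_, ?_, ?_, ?_⟩
  · refine Matrix.PosSemidef.mul_mul_conjTranspose_same ?_ _
    rw [Matrix.posSemidef_diagonal_iff]
    intro i
    exact_mod_cast posPart_nonneg _
  · refine Matrix.PosSemidef.mul_mul_conjTranspose_same ?_ _
    rw [Matrix.posSemidef_diagonal_iff]
    intro i
    exact_mod_cast negPart_nonneg _
  · rw [← Matrix.sub_mul, ← Matrix.mul_sub, Matrix.diagonal_sub, h]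
    congr
    funext i
    norm_cast
    exact (posPart_sub_negPart _).symm
  · rw [traceNorm, sqrt_conj_diagonal U a h, trace_conj_unitary, trace_conj_unitary,
      trace_conj_unitary, ← Matrix.trace_add, Matrix.diagonal_add]
    refine le_of_eq ?_
    congr
    funext i
    norm_cast
    exact posPart_add_negPart _

/-- In an eigenbasis of `P - Q` each eigenvalue is a difference of nonnegative diagonal entries of
`P` and `Q`, so its absolute value is at most their sum. -/
theorem TraceBound.traceNorm_le {b : ℝ} {X : Matrix ι ι ℂ} (hX : TraceBound b X) :
    traceNorm X ≤ b := by
  obtain ⟨P, Q, hP, hQ, rfl, hb⟩ := hX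
  obtain ⟨U, a, h⟩ := exists_unitary_diagonal (hP.1.sub hQ.1)
  refine le_trans ?_ hb
  have hU : (U : Matrix ι ι ℂ)ᴴ * (U : Matrix ι ι ℂ) = 1 :=
    (Matrix.mem_unitaryGroup_iff').1 U.2
  have hd : Matrix.diagonal (fun i => (a i : ℂ)) =
      (U : Matrix ι ι ℂ)ᴴ * P * (U : Matrix ι ι ℂ) -
      (U : Matrix ι ι ℂ)ᴴ * Q * (U : Matrix ι ι ℂ) := by
    rw [← Matrix.sub_mul, ← Matrix.mul_sub, h]
    simp only [Matrix.mul_assoc]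
    rw [hU, Matrix.mul_one, ← Matrix.mul_assoc, hU, Matrix.one_mul]
  have tr : ∀ A : Matrix ι ι ℂ,
      ((U : Matrix ι ι ℂ)ᴴ * A * (U : Matrix ι ι ℂ)).trace = A.trace := fun A => by
    have hU' : (U : Matrix ι ι ℂ) * (U : Matrix ι ι ℂ)ᴴ = 1 := Matrix.mem_unitaryGroup_iff.1 U.2
    rw [Matrix.trace_mul_comm, ← Matrix.mul_assoc, hU', Matrix.one_mul]
  have hP' := hP.conjTranspose_mul_mul_same (U : Matrix ι ι ℂ)
  have hQ' := hQ.conjTranspose_mul_mul_same (U : Matrix ι ι ℂ)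
  rw [traceNorm, sqrt_conj_diagonal U a h, trace_conj_unitary, ← tr P, ← tr Q]
  simp only [Matrix.trace, Complex.add_re, Complex.re_sum, ← Finset.sum_add_distrib]
  refine Finset.sum_le_sum fun i _ => ?_
  have h1 := congrArg Complex.re (congrFun (congrFun hd i) i)
  have h2 := (Complex.le_def.1 (hP'.diag_nonneg (i := i))).1
  have h3 := (Complex.le_def.1 (hQ'.diag_nonneg (i := i))).1
  simp only [Matrix.diagonal_apply_eq, Matrix.sub_apply, Complex.sub_re, Complex.ofReal_re,
    Complex.zero_re] at h1 h2 h3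
  simp only [Matrix.diag_apply, Matrix.diagonal_apply_eq, Complex.ofReal_re]
  rw [h1]
  exact abs_le.2 ⟨by linarith, by linarith⟩

end TraceNorm

/-! ### Products of local operators -/

section LocalProd

variable {N : ℕ} {d e f : Fin N → Type}

theorem localProd_apply (A : ∀ p, Matrix (e p) (d p) ℂ) (y : ∀ p, e p) (x : ∀ p, d p) :
    localProd A y x = ∏ p, A p (y p) (x p) := rfl

theorem localProd_mul [∀ p, Fintype (e p)] (A : ∀ p, Matrix (f p) (e p) ℂ)
    (B : ∀ p, Matrix (e p) (d p) ℂ) :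
    localProd A * localProd B = localProd fun p => A p * B p := by
  ext y x
  simp only [localProd_apply, Matrix.mul_apply, Finset.prod_univ_sum, Fintype.piFinset_univ,
    Finset.prod_mul_distrib]

theorem localProd_one [∀ p, DecidableEq (d p)] :
    localProd (fun p => (1 : Matrix (d p) (d p) ℂ)) = 1 := by
  ext y x
  simp only [localProd_apply, Matrix.one_apply, Finset.prod_ite_zero, funext_iff]
  simp

theorem localProd_conjTranspose (A : ∀ p, Matrix (e p) (d p) ℂ) :
    (localProd A)ᴴ = localProd fun p => (A p)ᴴ := by
  ext y x
  simp [localProd_apply, Matrix.conjTranspose_apply]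

theorem sum_localProd {κ : Fin N → Type} [∀ p, Fintype (κ p)]
    (A : ∀ p, κ p → Matrix (e p) (d p) ℂ) :
    ∑ k : ∀ p, κ p, localProd (fun p => A p (k p)) = localProd fun p => ∑ j, A p j := by
  ext y x
  simp only [Matrix.sum_apply, localProd_apply, Finset.prod_univ_sum, Fintype.piFinset_univ]

theorem sum_localProd_conjTranspose_mul_self [∀ p, DecidableEq (d p)]
    {κ : Fin N → Type} [∀ p, Fintype (κ p)] {d' : ∀ p, κ p → Type} [∀ p j, Fintype (d' p j)]
    (A : ∀ p j, Matrix (d' p j) (d p) ℂ) (hA : ∀ p, ∑ j, (A p j)ᴴ * A p j = 1) :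
    ∑ k : ∀ p, κ p, (localProd fun p => A p (k p))ᴴ * (localProd fun p => A p (k p)) = 1 := by
  simp only [localProd_conjTranspose, localProd_mul]
  rw [sum_localProd fun p j => (A p j)ᴴ * A p j]
  simp only [hA, localProd_one]

end LocalProd

/-! ### LOCC maps are linear, positive, trace preserving and composable -/

section Basic

variable {N : ℕ} {d e f : Fin N → Type} [∀ p, Fintype (d p)] [∀ p, DecidableEq (d p)]
  [∀ p, Fintype (e p)] [∀ p, DecidableEq (e p)] [∀ p, Fintype (f p)] [∀ p, DecidableEq (f p)]

theorem IsLOCC.isLinearMap {Λ : Op d → Op e} (h : IsLOCC Λ) : IsLinearMap ℂ Λ := by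
  induction h with
  | done => exact ⟨fun _ _ => rfl, fun _ _ => rfl⟩
  | round κ d' A hA Λ hΛ ih =>
    constructor
    · intro X Y
      rw [← Finset.sum_add_distrib]
      refine Finset.sum_congr rfl fun k _ => ?_
      rw [← (ih k).map_add, Matrix.mul_add, Matrix.add_mul]
    · intro c X
      rw [Finset.smul_sum]
      refine Finset.sum_congr rfl fun k _ => ?_
      rw [← (ih k).map_smul, Matrix.mul_smul, Matrix.smul_mul]

theorem IsLOCC.map_sum {Λ : Op d → Op e} (h : IsLOCC Λ) {κ : Type} (s : Finset κ)
    (X : κ → Op d) : Λ (∑ k ∈ s, X k) = ∑ k ∈ s, Λ (X k) :=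
  _root_.map_sum (IsLinearMap.mk' Λ h.isLinearMap) X s

theorem IsLOCC.posSemidef {Λ : Op d → Op e} (h : IsLOCC Λ) {X : Op d} (hX : X.PosSemidef) :
    (Λ X).PosSemidef := by
  induction h with
  | done => exact hX
  | round κ d' A hA Λ hΛ ih =>
    exact Matrix.posSemidef_sum _ fun k _ => ih k (hX.mul_mul_conjTranspose_same _)

theorem IsLOCC.trace {Λ : Op d → Op e} (h : IsLOCC Λ) (X : Op d) :
    (Λ X).trace = X.trace := by
  induction h with
  | done => rfl
  | round κ d' A hA Λ hΛ ih =>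
    conv_rhs => rw [← Matrix.one_mul X, ← sum_localProd_conjTranspose_mul_self A hA,
      Finset.sum_mul, Matrix.trace_sum]
    rw [Matrix.trace_sum]
    refine Finset.sum_congr rfl fun k _ => ?_
    rw [ih, Matrix.trace_mul_comm, ← Matrix.mul_assoc]

theorem IsLOCC.isState {Λ : Op d → Op e} (h : IsLOCC Λ) {X : Op d} (hX : IsState X) :
    IsState (Λ X) :=
  ⟨h.posSemidef hX.1, by rw [h.trace, hX.2]⟩

theorem IsLOCC.traceBound {Λ : Op d → Op e} (h : IsLOCC Λ) {X : Op d} {b : ℝ}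
    (hX : TraceBound b X) : TraceBound b (Λ X) :=
  hX.map (fun X Y => h.isLinearMap.map_sub X Y) (fun _ => h.posSemidef) h.trace

/-- The second protocol is appended to every branch of the first; linearity of `Γ` moves it inside
the sum over outcomes. -/
theorem IsLOCC.comp {Λ : Op d → Op e} (h : IsLOCC Λ) {Γ : Op e → Op f} (hΓ : IsLOCC Γ) :
    IsLOCC (fun X => Γ (Λ X)) := by
  induction h with
  | done => exact hΓ
  | round κ d' A hA Λ hΛ ih =>
    convert IsLOCC.round κ d' A hA (fun k X => Γ (Λ k X)) ih using 1
    funext X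
    exact hΓ.map_sum _ _

theorem IsLOCC.localChannel {κ : Fin N → Type} [∀ p, Fintype (κ p)]
    (A : ∀ p, κ p → Matrix (e p) (d p) ℂ) (hA : ∀ p, ∑ j, (A p j)ᴴ * A p j = 1) :
    IsLOCC (fun X : Op d => ∑ k : (∀ p, κ p),
      localProd (fun p => A p (k p)) * X * (localProd (fun p => A p (k p)))ᴴ) :=
  IsLOCC.round κ (fun p _ => e p) A hA (fun _ X => X) fun _ => .done

end Basic

/-! ### Joint systems, partial traces, and protocols acting on one part -/

section Joint

variable {N : ℕ} {d c : Fin N → Type}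

/-- Basis vectors of a joint system are pairs of basis vectors of the subsystems. -/
@[simps]
def splitEquiv (d c : Fin N → Type) : (∀ p, Joint d c p) ≃ (∀ p, d p) × (∀ p, c p) where
  toFun x := (fun p => (x p).1, fun p => (x p).2)
  invFun y := fun p => (y.1 p, y.2 p)
  left_inv _ := rfl
  right_inv _ := rfl

theorem sum_joint {M : Type} [AddCommMonoid M] [∀ p, Fintype (d p)] [∀ p, Fintype (c p)]
    (F : (∀ p, Joint d c p) → M) :
    ∑ x, F x = ∑ a : ∀ p, d p, ∑ b : ∀ p, c p, F fun p => (a p, b p) := by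
  rw [← Fintype.sum_prod_type', ← (splitEquiv d c).symm.sum_comp]
  rfl

/-- The block of an operator on a joint system between two basis vectors of the second part. -/
def slice (X : Op (Joint d c)) (z w : ∀ p, c p) : Op d :=
  Matrix.of fun a b => X (fun p => (a p, z p)) (fun p => (b p, w p))

/-- `Λ ⊗ id`. -/
def ampl {e : Fin N → Type} (c : Fin N → Type) (Λ : Op d → Op e) (X : Op (Joint d c)) :
    Op (Joint e c) :=
  Matrix.of fun x y => Λ (slice X (fun p => (x p).2) fun p => (y p).2)
    (fun p => (x p).1) (fun p => (y p).1)

variable {e : Fin N → Type} [∀ p, Fintype (d p)] [∀ p, DecidableEq (d p)]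
  [∀ p, Fintype (e p)] [∀ p, DecidableEq (e p)] [∀ p, Fintype (c p)] [∀ p, DecidableEq (c p)]

open scoped Kronecker in
theorem localProd_kronecker_one (A : ∀ p, Matrix (e p) (d p) ℂ) (a : ∀ p, e p) (z : ∀ p, c p)
    (x : ∀ p, Joint d c p) :
    localProd (fun p => A p ⊗ₖ (1 : Matrix (c p) (c p) ℂ)) (fun p => (a p, z p)) x =
      localProd A a (fun p => (x p).1) * if z = fun p => (x p).2 then 1 else 0 := by
  simp only [localProd_apply, Matrix.kroneckerMap_apply, Finset.prod_mul_distrib,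
    Matrix.one_apply, Finset.prod_ite_zero, funext_iff]
  simp

-- Kraus operators of the form `A ⊗ 1` act on each block separately. This identifies the blockwise
-- definition of `ampl` with a genuine LOCC protocol.
open scoped Kronecker in
theorem slice_conj_kronecker_one (A : ∀ p, Matrix (e p) (d p) ℂ) (X : Op (Joint d c))
    (z w : ∀ p, c p) :
    slice (localProd (fun p => A p ⊗ₖ (1 : Matrix (c p) (c p) ℂ)) * X *
      (localProd (fun p => A p ⊗ₖ (1 : Matrix (c p) (c p) ℂ)))ᴴ) z w =
      localProd A * slice X z w * (localProd A)ᴴ := by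
  ext a b
  simp only [slice, Matrix.of_apply, Matrix.mul_apply, Matrix.conjTranspose_apply,
    localProd_kronecker_one, sum_joint]
  simp [Finset.sum_mul, apply_ite (starRingEnd ℂ)]

open scoped Kronecker in
theorem IsLOCC.ampl {Λ : Op d → Op e} (h : IsLOCC Λ) (c : Fin N → Type) [∀ p, Fintype (c p)]
    [∀ p, DecidableEq (c p)] : IsLOCC (ampl c Λ) := by
  induction h with
  | done => exact IsLOCC.done
  | round κ d' A hA Λ hΛ ih =>
    convert IsLOCC.round (d := Joint _ c) (e := Joint e c) κ (fun p j => d' p j × c p)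
      (fun p j => A p j ⊗ₖ (1 : Matrix (c p) (c p) ℂ)) ?_ (fun k => QEnt.ampl c (Λ k)) ih using 1
    · funext X
      ext x y
      simp only [QEnt.ampl, Matrix.of_apply, Matrix.sum_apply]
      refine Finset.sum_congr rfl fun k _ => ?_
      rw [slice_conj_kronecker_one]
    · intro p
      simp only [Matrix.conjTranspose_kronecker, ← Matrix.mul_kronecker_mul,
        Matrix.conjTranspose_one, Matrix.mul_one]
      rw [← Matrix.one_kronecker_one, ← hA]
      ext x y
      simp only [Matrix.sum_apply, Matrix.kroneckerMap_apply, Finset.sum_mul]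

theorem ampl_tensor {Λ : Op d → Op e} (h : IsLinearMap ℂ Λ) (ρ : Op d) (τ : Op c) :
    ampl c Λ (tensor ρ τ) = tensor (Λ ρ) τ := by
  ext x y
  have : slice (tensor ρ τ) (fun p => (x p).2) (fun p => (y p).2) =
      τ (fun p => (x p).2) (fun p => (y p).2) • ρ := by
    ext a b
    simp [slice, tensor, mul_comm]
  simp only [ampl, tensor, Matrix.of_apply] at this ⊢
  rw [this, h.map_smul]
  simp [mul_comm]

theorem marginalC_eq_trace (X : Op (Joint d c)) (z w : ∀ p, c p) :
    marginalC X z w = (slice X z w).trace := rfl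

theorem marginalS_eq_sum (X : Op (Joint d c)) : marginalS X = ∑ z, slice X z z := by
  ext x y
  simp [marginalS, slice, Matrix.sum_apply]

/-- No signalling: the entries of the marginal are traces of blocks, and `Λ` preserves the trace. -/
theorem marginalC_ampl {Λ : Op d → Op e} (h : IsLOCC Λ) (X : Op (Joint d c)) :
    marginalC (ampl c Λ X) = marginalC X := by
  ext z w
  rw [marginalC_eq_trace, marginalC_eq_trace, ← h.trace]
  rfl

theorem marginalS_ampl {Λ : Op d → Op e} (h : IsLinearMap ℂ Λ) (X : Op (Joint d c)) :
    marginalS (ampl c Λ X) = Λ (marginalS X) := by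
  have := map_sum (IsLinearMap.mk' Λ h) (fun z => slice X z z) Finset.univ
  rw [marginalS_eq_sum, marginalS_eq_sum]
  exact this.symm

theorem marginalS_tensor (ρ : Op d) (τ : Op c) :
    marginalS (tensor ρ τ) = τ.trace • ρ := by
  ext x y
  simp [marginalS, tensor, Matrix.trace, ← Finset.mul_sum, mul_comm]

theorem marginalC_tensor (ρ : Op d) (τ : Op c) :
    marginalC (tensor ρ τ) = ρ.trace • τ := by
  ext x y
  simp [marginalC, tensor, Matrix.trace, ← Finset.sum_mul]

theorem trace_tensor (ρ : Op d) (τ : Op c) :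
    (tensor ρ τ).trace = ρ.trace * τ.trace := by
  simp only [Matrix.trace, sum_joint, Finset.sum_mul_sum]
  rfl

/-- Each party measures its share of the second part in the computational basis and forgets the
outcome. -/
theorem IsLOCC.marginalS (d c : Fin N → Type) [∀ p, Fintype (d p)] [∀ p, DecidableEq (d p)]
    [∀ p, Fintype (c p)] [∀ p, DecidableEq (c p)] :
    IsLOCC (marginalS : Op (Joint d c) → Op d) := by
  convert IsLOCC.localChannel (d := Joint d c) (e := d) (κ := c)
    (fun p z => Matrix.of fun a x => if x = (a, z) then 1 else 0) ?_ using 1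
  · funext X
    ext a b
    have key : ∀ (k : ∀ p, c p) (a : ∀ p, d p) (x : ∀ p, Joint d c p),
        localProd (fun p => Matrix.of fun (a : d p) (x : d p × c p) =>
          if x = (a, k p) then (1 : ℂ) else 0) a x = if x = fun p => (a p, k p) then 1 else 0 := by
      intro k a x
      simp only [localProd_apply, Matrix.of_apply, Finset.prod_ite_zero, funext_iff]
      simp
    simp [Matrix.sum_apply, Matrix.mul_apply, Matrix.conjTranspose_apply, key,
      QEnt.marginalS]
  · intro p
    ext x y
    simp only [Matrix.sum_apply, Matrix.mul_apply, Matrix.conjTranspose_apply, Matrix.of_apply,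
      Matrix.one_apply]
    rw [Finset.sum_comm, ← Fintype.sum_prod_type']
    simp

end Joint

/-! ### Local isometries and relabellings -/

section Embed

variable {N : ℕ} {d e f : Fin N → Type} [∀ p, Fintype (d p)] [∀ p, DecidableEq (d p)]
  [∀ p, Fintype (e p)] [∀ p, DecidableEq (e p)]

/-- The isometry between systems given by maps of the local bases. -/
def basisMap (f : ∀ p, d p → e p) : Matrix (∀ p, e p) (∀ p, d p) ℂ :=
  Matrix.of fun y x => if y = fun p => f p (x p) then 1 else 0

/-- The operation that maps local basis vectors as `f` does. -/
def embed (f : ∀ p, d p → e p) (X : Op d) : Op e := basisMap f * X * (basisMap f)ᴴ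

theorem IsLOCC.embed {f : ∀ p, d p → e p} (hf : ∀ p, (f p).Injective) : IsLOCC (embed f) := by
  convert IsLOCC.localChannel (d := d) (e := e) (κ := fun _ => Unit)
    (fun p _ => Matrix.of fun y x => if y = f p x then 1 else 0) ?_ using 1
  · funext X
    have : localProd (fun p => Matrix.of fun y x => if y = f p x then (1 : ℂ) else 0) =
        basisMap f := by
      ext y x
      simp only [localProd_apply, basisMap, Matrix.of_apply, Finset.prod_ite_zero, funext_iff]
      simp
    simp [this, QEnt.embed]
  · intro p
    ext x y
    simp [Matrix.mul_apply, Matrix.conjTranspose_apply, Matrix.one_apply, (hf p).eq_iff,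
      eq_comm]

theorem embed_equiv (f : ∀ p, d p ≃ e p) (X : Op d) :
    embed (fun p => f p) X =
      X.submatrix (fun y p => (f p).symm (y p)) (fun y p => (f p).symm (y p)) := by
  ext y y'
  have key : ∀ (y : ∀ p, e p) (x : ∀ p, d p),
      (y = fun p => f p (x p)) ↔ x = fun p => (f p).symm (y p) := fun y x => by
    simp only [funext_iff, Equiv.eq_symm_apply, eq_comm]
  simp [embed, basisMap, Matrix.mul_apply, Matrix.conjTranspose_apply, key]

/-- A local relabelling of the basis is a local unitary. Regroupings of tensor factors are obtained
from this. -/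
theorem IsLOCC.reindex (f : ∀ p, e p ≃ d p) :
    IsLOCC (fun X : Op d => X.submatrix (fun y p => f p (y p)) (fun y p => f p (y p))) := by
  convert IsLOCC.embed (f := fun p => (f p).symm) (fun p => (f p).symm.injective) using 1
  funext X
  exact (embed_equiv (fun p => (f p).symm) X).symm

/-- Exchange of the two parts of a joint system. -/
def swap {c : Fin N → Type} (X : Op (Joint d c)) : Op (Joint c d) :=
  X.submatrix (fun y p => ((y p).2, (y p).1)) (fun y p => ((y p).2, (y p).1))

variable {c : Fin N → Type} [∀ p, Fintype (c p)] [∀ p, DecidableEq (c p)]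

theorem IsLOCC.swap : IsLOCC (swap : Op (Joint d c) → Op (Joint c d)) :=
  IsLOCC.reindex (d := Joint d c) (e := Joint c d) fun p => Equiv.prodComm (c p) (d p)

theorem marginalS_swap (X : Op (Joint d c)) : marginalS (swap X) = marginalC X := rfl

theorem marginalC_swap (X : Op (Joint d c)) : marginalC (swap X) = marginalS X := rfl

theorem IsLOCC.marginalC (d c : Fin N → Type) [∀ p, Fintype (d p)] [∀ p, DecidableEq (d p)]
    [∀ p, Fintype (c p)] [∀ p, DecidableEq (c p)] :
    IsLOCC (marginalC : Op (Joint d c) → Op c) :=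
  IsLOCC.swap.comp (IsLOCC.marginalS c d)

/-- Any state of a system can be replaced by a fixed product state. -/
theorem IsLOCC.exists_of_nonempty (d e : Fin N → Type) [∀ p, Fintype (d p)]
    [∀ p, DecidableEq (d p)] [∀ p, Fintype (e p)] [∀ p, DecidableEq (e p)]
    [∀ p, Nonempty (e p)] : ∃ Λ : Op d → Op e, IsLOCC Λ :=
  ⟨_, (IsLOCC.embed (e := Joint e d)
    (f := fun p x => (Classical.arbitrary (e p), x)) fun _ _ _ h => (Prod.ext_iff.1 h).2).comp
    (IsLOCC.marginalS e d)⟩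

end Embed

/-! ### Splitting off one copy -/

section Copies

variable {N : ℕ} {d : Fin N → Type} {n : ℕ}

/-- Adjoining one further copy of a system in front of `n` copies. -/
def consCopy (X : Op (Joint d (Copies d n))) : Op (Copies d (n + 1)) :=
  X.submatrix (fun x p => (x p 0, fun i => x p i.succ)) (fun x p => (x p 0, fun i => x p i.succ))

/-- Splitting off the first copy of a system. -/
def unconsCopy (X : Op (Copies d (n + 1))) : Op (Joint d (Copies d n)) :=
  X.submatrix (fun x p => Fin.cons (x p).1 (x p).2) (fun x p => Fin.cons (x p).1 (x p).2)

theorem unconsCopy_consCopy (X : Op (Joint d (Copies d n))) : unconsCopy (consCopy X) = X := by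
  ext x y
  simp [unconsCopy, consCopy]

theorem consCopy_unconsCopy (X : Op (Copies d (n + 1))) : consCopy (unconsCopy X) = X := by
  ext x y
  have : ∀ x : ∀ p, Copies d (n + 1) p,
      (fun p => Fin.cons (x p 0) fun i => x p i.succ) = x := fun x => by
    funext p
    exact Fin.cons_self_tail (x p)
  simp only [unconsCopy, consCopy, Matrix.submatrix_apply, this]

theorem consCopy_tensor_power (ρ : Op d) (n : ℕ) :
    consCopy (tensor ρ (power ρ n)) = power ρ (n + 1) := by
  ext x y
  simp [consCopy, tensor, power, Fin.prod_univ_succ]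

theorem unconsCopy_power (ρ : Op d) (n : ℕ) :
    unconsCopy (power ρ (n + 1)) = tensor ρ (power ρ n) := by
  rw [← consCopy_tensor_power, unconsCopy_consCopy]

variable [∀ p, Fintype (d p)] [∀ p, DecidableEq (d p)]

theorem IsLOCC.consCopy :
    IsLOCC (consCopy : Op (Joint d (Copies d n)) → Op (Copies d (n + 1))) := by
  exact IsLOCC.reindex (d := Joint d (Copies d n)) (e := Copies d (n + 1))
    fun p => (Fin.consEquiv fun _ => d p).symm

theorem IsLOCC.unconsCopy :
    IsLOCC (unconsCopy : Op (Copies d (n + 1)) → Op (Joint d (Copies d n))) := by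
  exact IsLOCC.reindex (e := Joint d (Copies d n)) (d := Copies d (n + 1))
    fun p => Fin.consEquiv fun _ => d p

theorem sum_copies_succ {M : Type} [AddCommMonoid M] (F : (∀ p, Copies d (n + 1) p) → M) :
    ∑ u, F u = ∑ a : ∀ p, d p, ∑ b : ∀ p, Copies d n p, F fun p => Fin.cons (a p) (b p) := by
  rw [← sum_joint (d := d) (c := Copies d n) fun x => F fun p => Fin.cons (x p).1 (x p).2]
  exact (Equiv.sum_comp (Equiv.piCongrRight fun p => Fin.consEquiv fun _ => d p) F).symm

theorem copyMarginal_zero_consCopy (X : Op (Joint d (Copies d n))) :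
    copyMarginal 0 (consCopy X) = marginalS X := by
  ext x y
  simp only [copyMarginal, Matrix.of_apply, Finset.sum_filter, sum_copies_succ, consCopy]
  simp [marginalS]

theorem copyMarginal_succ_consCopy (X : Op (Joint d (Copies d n))) (i : Fin n) :
    copyMarginal i.succ (consCopy X) = copyMarginal i (marginalC X) := by
  ext x y
  simp only [copyMarginal, Matrix.of_apply, Finset.sum_filter, sum_copies_succ, consCopy]
  rw [Finset.sum_comm]
  refine Finset.sum_congr rfl fun u _ => ?_
  simp [marginalC, ← Fin.cons_update]

/-- Leading copies are discarded until the wanted one is first. Trace norm bounds thereby pass to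
the marginals. -/
theorem IsLOCC.copyMarginal (i : Fin n) :
    IsLOCC (copyMarginal i : Op (Copies d n) → Op d) := by
  induction n with
  | zero => exact i.elim0
  | succ n ih =>
    have key : (QEnt.copyMarginal i : Op (Copies d (n + 1)) → Op d) =
        fun X => QEnt.copyMarginal i (QEnt.consCopy (QEnt.unconsCopy X)) := by
      funext X
      rw [consCopy_unconsCopy]
    rw [key]
    refine Fin.cases ?_ (fun i => ?_) i
    · simp only [copyMarginal_zero_consCopy]
      exact IsLOCC.unconsCopy.comp (IsLOCC.marginalS _ _)
    · simp only [copyMarginal_succ_consCopy]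
      exact (IsLOCC.unconsCopy.comp (IsLOCC.marginalC _ _)).comp (ih i)

end Copies

/-! ### Products of states -/

section States

variable {N : ℕ} {d c : Fin N → Type} [∀ p, Fintype (d p)] [∀ p, DecidableEq (d p)]
  [∀ p, Fintype (c p)] [∀ p, DecidableEq (c p)]

open scoped Kronecker in
theorem IsState.tensor {ρ : Op d} {τ : Op c} (hρ : IsState ρ) (hτ : IsState τ) :
    IsState (tensor ρ τ) := by
  refine ⟨?_, by rw [trace_tensor, hρ.2, hτ.2, one_mul]⟩
  exact (hρ.1.kronecker hτ.1).submatrix (splitEquiv d c)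

theorem IsState.power {ρ : Op d} (hρ : IsState ρ) (n : ℕ) : IsState (power ρ n) := by
  induction n with
  | zero =>
    have : QEnt.power ρ 0 = 1 := by
      ext x y
      rw [Subsingleton.elim x y]
      simp [QEnt.power]
    rw [this]
    exact ⟨.one, by simp⟩
  | succ n ih =>
    rw [← consCopy_tensor_power]
    exact IsLOCC.consCopy.isState (hρ.tensor ih)

theorem IsState.nonempty {ρ : Op d} (hρ : IsState ρ) (p : Fin N) : Nonempty (d p) := by
  by_contra h
  rw [not_nonempty_iff] at h
  have : IsEmpty (∀ p, d p) := ⟨fun x => h.elim (x p)⟩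
  have h1 := hρ.2
  simp [Matrix.trace] at h1

theorem TraceBound.tensor_right {b : ℝ} {X : Op d} (h : TraceBound b X) {τ : Op c}
    (hτ : IsState τ) : TraceBound b (tensor X τ) := by
  refine h.map (Λ := fun X => QEnt.tensor X τ) (fun X Y => ?_) (fun X hX => ?_) fun X => ?_
  · ext x y
    simp [tensor, sub_mul]
  · exact (hX.kronecker hτ.1).submatrix (splitEquiv d c)
  · rw [trace_tensor, hτ.2, mul_one]

end States

/-! ### Catalysts with a cyclically permuted public register -/

section CyclicCatalyst

variable {N : ℕ} {d e : Fin N → Type} [∀ p, Fintype (d p)] [∀ p, DecidableEq (d p)]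
  [∀ p, Fintype (e p)] [∀ p, DecidableEq (e p)]
  {K : Type} [Fintype K] [DecidableEq K] {V : K → Fin N → Type}
  [∀ k p, Fintype (V k p)] [∀ k p, DecidableEq (V k p)]

/-- The system with a classical register `k`, known to all parties, and a system `V k`. -/
abbrev Sector (V : K → Fin N → Type) : Fin N → Type := fun p => Σ k, V k p

/-- The operator `|k⟩⟨k| ⊗ T`. -/
def sector (k : K) (T : Op (V k)) : Op (Sector V) :=
  embed (fun p (v : V k p) => (⟨k, v⟩ : Sector V p)) T

theorem IsLOCC.sector (k : K) : IsLOCC (sector k : Op (V k) → Op (Sector V)) :=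
  IsLOCC.embed fun p x y h => by simpa using h

theorem sector_apply_of_ne (k : Fin N → K) (k₀ : K) (h : k ≠ fun _ => k₀) (T : Op (V k₀))
    (v : ∀ p, V (k p) p) (y : ∀ p, Sector V p) :
    sector k₀ T (fun p => ⟨k p, v p⟩) y = 0 := by
  have : ∀ v' : ∀ p, V k₀ p, (fun p => (⟨k p, v p⟩ : Sector V p)) ≠ fun p => ⟨k₀, v' p⟩ :=
    fun v' h' => h (funext fun p => congrArg Sigma.fst (congrFun h' p))
  simp [sector, embed, basisMap, Matrix.mul_apply, this]

theorem sector_apply_self (k : K) (T : Op (V k)) (v w : ∀ p, V k p) :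
    sector k T (fun p => ⟨k, v p⟩) (fun p => ⟨k, w p⟩) = T v w := by
  have : ∀ v v' : ∀ p, V k p, ((fun p => (⟨k, v p⟩ : Sector V p)) = fun p => ⟨k, v' p⟩) ↔
      v' = v := fun v v' => by simp [funext_iff, eq_comm]
  simp [sector, embed, basisMap, Matrix.mul_apply, Matrix.conjTranspose_apply, this]

/-- All parties measure the register of `Sector V` and continue with a protocol that depends on
its value. -/
theorem IsLOCC.exists_sectorwise {f : Fin N → Type} [∀ p, Fintype (f p)]
    [∀ p, DecidableEq (f p)] [∀ p, Nonempty (f p)] (p₀ : Fin N)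
    (G : ∀ k, Op (Joint d (V k)) → Op f) (hG : ∀ k, IsLOCC (G k)) :
    ∃ Λ : Op (Joint d (Sector V)) → Op f, IsLOCC Λ ∧
      ∀ (ρ : Op d) (T : ∀ k, Op (V k)), Λ (tensor ρ (∑ k, QEnt.sector k (T k))) =
        ∑ k, G k (tensor ρ (T k)) := by
  -- A protocol must be given for every tuple of announced values. Tuples on which the parties
  -- disagree have weight zero on the relevant states, so any protocol will do there.
  have hfam : ∀ k : Fin N → K, ∃ Γ : Op (fun p => d p × V (k p) p) → Op f, IsLOCC Γ ∧
      ∀ (k₀ : K) (h : k = fun _ => k₀), Γ = h ▸ G k₀ := by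
    intro k
    by_cases h : ∃ k₀, k = fun _ => k₀
    · obtain ⟨k₀, rfl⟩ := h
      refine ⟨G k₀, hG k₀, fun k₁ h => ?_⟩
      obtain rfl : k₀ = k₁ := congrFun h p₀
      rfl
    · obtain ⟨Γ, hΓ⟩ := IsLOCC.exists_of_nonempty (fun p => d p × V (k p) p) f
      exact ⟨Γ, hΓ, fun k₀ hk => absurd ⟨k₀, hk⟩ h⟩
  choose Γ hΓ hconst using hfam
  let A : ∀ p (k : K), Matrix (d p × V k p) (d p × Sector V p) ℂ := fun p k =>
    Matrix.of fun a x => if x = (a.1, ⟨k, a.2⟩) then 1 else 0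
  have hA : ∀ p, ∑ k, (A p k)ᴴ * A p k = 1 := by
    intro p
    ext ⟨s, k, v⟩ ⟨s', k', v'⟩
    simp only [A, Matrix.sum_apply, Matrix.mul_apply, Matrix.conjTranspose_apply,
      Matrix.of_apply, Matrix.one_apply]
    rw [Finset.sum_eq_single k, Finset.sum_eq_single (s, v)]
    · simp only [mul_ite, mul_one, mul_zero, star_one, if_true]
      exact if_congr eq_comm rfl rfl
    · rintro ⟨t, u⟩ - h
      have : ¬ ((s, (⟨k, v⟩ : Sector V p)) = (t, ⟨k, u⟩)) := by
        rintro h'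
        simp only [Prod.mk.injEq, Sigma.mk.injEq, heq_eq_eq, true_and] at h'
        exact h (by rw [h'.1, h'.2])
      simp [this]
    · simp
    · intro j _ hj
      refine Finset.sum_eq_zero fun a _ => ?_
      have : ¬ ((s, (⟨k, v⟩ : Sector V p)) = (a.1, ⟨j, a.2⟩)) := by
        rintro h'
        simp only [Prod.mk.injEq, Sigma.mk.injEq] at h'
        exact hj h'.2.1.symm
      simp [this]
    · simp
  have key : ∀ (k : Fin N → K) (X : Op (Joint d (Sector V))),
      localProd (fun p => A p (k p)) * X * (localProd fun p => A p (k p))ᴴ =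
        X.submatrix (fun (a : ∀ p, d p × V (k p) p) p => ((a p).1, ⟨k p, (a p).2⟩))
          (fun (a : ∀ p, d p × V (k p) p) p => ((a p).1, ⟨k p, (a p).2⟩)) := by
    intro k X
    have h1 : ∀ (a : ∀ p, d p × V (k p) p) (x : ∀ p, Joint d (Sector V) p),
        localProd (fun p => A p (k p)) a x =
          if x = fun p => ((a p).1, ⟨k p, (a p).2⟩) then 1 else 0 := by
      intro a x
      simp only [A, localProd_apply, Matrix.of_apply, Finset.prod_ite_zero, funext_iff]
      simp
    ext a b
    simp [Matrix.mul_apply, Matrix.conjTranspose_apply, h1]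
  refine ⟨_, IsLOCC.round (d := Joint d (Sector V)) (fun _ => K) (fun p k => d p × V k p) A hA
    Γ hΓ, fun ρ T => ?_⟩
  simp only [key]
  symm
  -- Only the constant tuples contribute; `p₀` supplies a party from which the common value is read
  -- off.
  refine Fintype.sum_of_injective (fun (k : K) (_ : Fin N) => k) (fun a b h => congrFun h p₀)
    _ _ (fun k hk => ?_) fun k => ?_
  · have : (tensor ρ (∑ k, QEnt.sector k (T k))).submatrix
        (fun (a : ∀ p, d p × V (k p) p) p => ((a p).1, (⟨k p, (a p).2⟩ : Sector V p)))
        (fun (a : ∀ p, d p × V (k p) p) p => ((a p).1, ⟨k p, (a p).2⟩)) = 0 := by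
      ext a b
      simp only [tensor, Matrix.submatrix_apply, Matrix.of_apply, Matrix.sum_apply,
        Matrix.zero_apply]
      rw [Finset.sum_eq_zero, mul_zero]
      intro k₀ _
      exact sector_apply_of_ne k k₀ (fun h => hk ⟨k₀, h.symm⟩) _ _ _
    rw [this]
    exact (hΓ k).isLinearMap.map_zero
  · have h1 : Γ (fun _ => k) = G k := hconst (fun _ => k) k rfl
    simp only [h1]
    congr 1
    ext a b
    simp only [tensor, Matrix.submatrix_apply, Matrix.of_apply, Matrix.sum_apply]
    congr 1
    rw [Finset.sum_eq_single k]
    · exact (sector_apply_self k _ _ _).symm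
    · intro k₀ _ h
      exact sector_apply_of_ne (fun _ => k) k₀ (fun h' => h (congrFun h' p₀).symm) _ _ _
    · simp

/-- If the states `T k` of catalysts `V k` are carried around a cycle by protocols that consume
`ρ` and leave a system in the state `R k`, then their uniform mixture is a catalyst for the
conversion of `ρ` into the average of the `R k`. -/
theorem exists_cyclic_catalyst [Nonempty K] [∀ p, Nonempty (e p)] [∀ k p, Nonempty (V k p)]
    (p₀ : Fin N) (π : Equiv.Perm K) (ρ : Op d) (T : ∀ k, Op (V k)) (hT : ∀ k, IsState (T k))
    (R : K → Op e)
    (step : ∀ k, ∃ Γ : Op (Joint d (V k)) → Op (Joint e (V (π k))), IsLOCC Γ ∧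
      marginalS (Γ (tensor ρ (T k))) = R (π k) ∧ marginalC (Γ (tensor ρ (T k))) = T (π k)) :
    ∃ (c : Fin N → Type) (_ : ∀ p, Fintype (c p)) (_ : ∀ p, DecidableEq (c p))
      (τ : Op c) (Λ : Op (Joint d c) → Op (Joint e c)), IsState τ ∧ IsLOCC Λ ∧
        marginalS (Λ (tensor ρ τ)) = (Fintype.card K : ℂ)⁻¹ • ∑ k, R k ∧
        marginalC (Λ (tensor ρ τ)) = τ := by
  choose Γ hΓ hS hC using step
  let G : ∀ k, Op (Joint d (V k)) → Op (Joint e (Sector V)) := fun k X =>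
    swap (ampl e (sector (π k)) (swap (Γ k X)))
  have hG : ∀ k, IsLOCC (G k) := fun k =>
    (((hΓ k).comp IsLOCC.swap).comp ((IsLOCC.sector (π k)).ampl e)).comp IsLOCC.swap
  have : ∀ p, Nonempty (Sector V p) := fun p =>
    ⟨⟨Classical.arbitrary K, Classical.arbitrary _⟩⟩
  obtain ⟨Λ, hΛ, hΛT⟩ := IsLOCC.exists_sectorwise p₀ G hG
  have hcard : (Fintype.card K : ℂ) ≠ 0 := by exact_mod_cast Fintype.card_ne_zero
  let τ : Op (Sector V) := (Fintype.card K : ℂ)⁻¹ • ∑ k, sector k (T k)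
  have hout : Λ (tensor ρ τ) = (Fintype.card K : ℂ)⁻¹ • ∑ k, G k (tensor ρ (T k)) := by
    rw [← hΛT, ← hΛ.isLinearMap.map_smul]
    congr 1
    ext x y
    simp [τ, tensor, mul_left_comm]
  refine ⟨Sector V, inferInstance, inferInstance, τ, Λ, ⟨?_, ?_⟩, hΛ, ?_, ?_⟩
  · refine Matrix.PosSemidef.smul (Matrix.posSemidef_sum _ fun k _ => ?_) ?_
    · exact (IsLOCC.sector k).posSemidef (hT k).1
    · rw [← Complex.ofReal_natCast, ← Complex.ofReal_inv]
      exact_mod_cast inv_nonneg.2 (Nat.cast_nonneg (α := ℝ) (Fintype.card K))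
  · simp only [τ, Matrix.trace_smul, Matrix.trace_sum]
    rw [Finset.sum_congr rfl fun k _ => ((IsLOCC.sector k).trace (T k)).trans (hT k).2]
    simp [hcard]
  · have hm := IsLOCC.marginalS e (Sector V)
    rw [hout, hm.isLinearMap.map_smul, hm.map_sum]
    congr 1
    rw [← Equiv.sum_comp π R]
    refine Finset.sum_congr rfl fun k _ => ?_
    simp only [G, marginalS_swap]
    rw [marginalC_ampl (IsLOCC.sector (π k)), marginalC_swap, hS]
  · have hm := IsLOCC.marginalC e (Sector V)
    rw [hout, hm.isLinearMap.map_smul, hm.map_sum]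
    simp only [τ]
    congr 1
    -- The catalyst is restored because `π` merely permutes the terms of the uniform mixture.
    rw [← Equiv.sum_comp π fun k => sector k (T k)]
    refine Finset.sum_congr rfl fun k _ => ?_
    simp only [G, marginalC_swap]
    rw [marginalS_ampl (IsLOCC.sector (π k)).isLinearMap, marginalS_swap, hC]

end CyclicCatalyst

/-! ### From marginal reducibility to correlated catalysis -/

section Reducible

variable {N : ℕ} {d e : Fin N → Type} [∀ p, Fintype (d p)] [∀ p, DecidableEq (d p)]
  [∀ p, Fintype (e p)] [∀ p, DecidableEq (e p)]

/-- The states of the last `b` copies of an `n`-copy state, for all `b ≤ n`. -/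
theorem exists_tails {n : ℕ} {μ : Op (Copies e n)} (hμ : IsState μ) :
    ∃ M : ∀ b, Op (Copies e b), M n = μ ∧ (∀ b ≤ n, IsState (M b)) ∧
      (∀ b < n, M b = marginalC (unconsCopy (M (b + 1)))) ∧
      ∑ b ∈ Finset.range n, marginalS (unconsCopy (M (b + 1))) =
        ∑ i : Fin n, copyMarginal i μ := by
  induction n with
  | zero =>
    refine ⟨Function.update (fun _ => 0) 0 μ, by simp, fun b hb => ?_, by simp, by simp⟩
    obtain rfl : b = 0 := by omega
    simpa using hμ
  | succ n ih =>
    obtain ⟨M, hMn, hMs, hM, hsum⟩ :=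
      ih (μ := marginalC (unconsCopy μ))
        ((IsLOCC.unconsCopy.comp (IsLOCC.marginalC _ _)).isState hμ)
    have hlt : ∀ b ≤ n, Function.update M (n + 1) μ b = M b := fun b hb =>
      Function.update_of_ne (by omega) _ _
    have htop : Function.update M (n + 1) μ (n + 1) = μ := Function.update_self ..
    refine ⟨Function.update M (n + 1) μ, htop, fun b hb => ?_, fun b hb => ?_, ?_⟩
    · rcases Nat.lt_or_ge n b with h | h
      · obtain rfl : b = n + 1 := by omega
        rwa [htop]
      · rw [hlt b h]
        exact hMs b h
    · rw [hlt b (by omega)]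
      rcases Nat.lt_or_ge b n with h | h
      · rw [hlt (b + 1) h, hM b h]
      · obtain rfl : b = n := by omega
        rw [htop, hMn]
    · rw [Finset.sum_range_succ, Fin.sum_univ_succ, htop, add_comm]
      have h0 : copyMarginal 0 μ = marginalS (unconsCopy μ) := by
        rw [← copyMarginal_zero_consCopy, consCopy_unconsCopy]
      have h1 : ∀ i : Fin n, copyMarginal i.succ μ =
          copyMarginal i (marginalC (unconsCopy μ)) := fun i => by
        rw [← copyMarginal_succ_consCopy, consCopy_unconsCopy]
      simp only [h0, h1, ← hsum]
      congr 1
      refine Finset.sum_congr rfl fun b hb => ?_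
      rw [hlt _ (by simpa [Nat.succ_le_iff] using hb)]

/-- Adjoining a fixed state as a first copy. -/
theorem IsLOCC.exists_padding (hne : ∀ p, Nonempty (e p)) :
    ∃ J : Op e, IsState J ∧ ∀ m j : ℕ, ∃ Λ : Op (Copies e m) → Op (Copies e (m + j)),
      IsLOCC Λ ∧ ∀ μ, IsState μ → ∑ i, QEnt.copyMarginal i (Λ μ) =
        (j : ℂ) • J + ∑ i, QEnt.copyMarginal i μ := by
  classical
  let z : ∀ p, e p := fun p => Classical.arbitrary (e p)
  let J : Op e := Matrix.vecMulVec (Pi.single z 1) (star (Pi.single z 1))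
  have hJ : IsState J := by
    refine ⟨Matrix.posSemidef_vecMulVec_self_star _, ?_⟩
    simp [J, Matrix.trace, Matrix.vecMulVec_apply, Pi.single_apply]
  refine ⟨J, hJ, fun m j => ?_⟩
  induction j with
  | zero => exact ⟨fun X => X, IsLOCC.done, by simp⟩
  | succ j ih =>
    obtain ⟨Λ, hΛ, hsum⟩ := ih
    have happ : IsLOCC fun X : Op (Copies e (m + j)) => tensor J X := by
      convert IsLOCC.embed (d := Copies e (m + j)) (e := Joint e (Copies e (m + j)))
        (f := fun p x => (z p, x)) (fun p x y h => (Prod.ext_iff.1 h).2) using 1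
      funext X
      ext x y
      have h1 : ∀ (x : ∀ p, Joint e (Copies e (m + j)) p) (u : ∀ p, Copies e (m + j) p),
          (x = fun p => (z p, u p)) ↔ ((fun p => (x p).1) = z ∧ u = fun p => (x p).2) := by
        intro x u
        simp only [funext_iff, Prod.ext_iff, forall_and, eq_comm]
      simp only [tensor, J, QEnt.embed, basisMap, Matrix.of_apply, Matrix.mul_apply,
        Matrix.conjTranspose_apply, h1, Matrix.vecMulVec_apply, Pi.single_apply, Pi.star_apply,
        ite_and]
      by_cases hx : (fun p => (x p).1) = z <;> by_cases hy : (fun p => (y p).1) = z <;>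
        simp [hx, hy]
    refine ⟨fun X => QEnt.consCopy (tensor J (Λ X)), (hΛ.comp happ).comp IsLOCC.consCopy,
      fun μ hμ => ?_⟩
    have : ∑ i, QEnt.copyMarginal i (QEnt.consCopy (tensor J (Λ μ))) =
        J + ∑ i, QEnt.copyMarginal i (Λ μ) := by
      rw [Fin.sum_univ_succ]
      simp only [copyMarginal_zero_consCopy, copyMarginal_succ_consCopy, marginalS_tensor,
        marginalC_tensor, hJ.2, (hΛ.isState hμ).2, one_smul]
    refine this.trans ?_
    rw [hsum μ hμ]
    push_cast
    rw [add_smul, one_smul]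
    abel

/-- Pure regrouping: the incoming ρ is stored and the first held copy of μ is released. The numbers
of copies are tied by equations because `L - b` does not reduce definitionally in the types. -/
theorem exists_shift_step {ρ : Op d} (hρ : IsState ρ) {a a' b b' : ℕ} (ha : a' = a + 1)
    (hb : b = b' + 1) (M : ∀ b, Op (Copies e b)) (hM : IsState (M b))
    (hM' : M b' = marginalC (unconsCopy (M (b' + 1)))) :
    ∃ Γ : Op (Joint d (Joint (Copies d a) (Copies e b))) →
        Op (Joint e (Joint (Copies d a') (Copies e b'))), IsLOCC Γ ∧
      marginalS (Γ (tensor ρ (tensor (power ρ a) (M b)))) =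
        marginalS (unconsCopy (M (b' + 1))) ∧
      marginalC (Γ (tensor ρ (tensor (power ρ a) (M b)))) =
        tensor (power ρ a') (M b') := by
  subst ha hb
  let f : ∀ p, Joint e (Joint (Copies d (a + 1)) (Copies e b')) p ≃
      Joint d (Joint (Copies d a) (Copies e (b' + 1))) p := fun p =>
    { toFun x := (x.2.1 0, (fun i => x.2.1 i.succ), Fin.cons x.1 x.2.2)
      invFun y := (y.2.2 0, Fin.cons y.1 y.2.1, fun i => y.2.2 i.succ)
      left_inv x := by
        refine Prod.ext (by simp) (Prod.ext ?_ (by simp))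
        exact Fin.cons_self_tail x.2.1
      right_inv y := by
        refine Prod.ext (by simp) (Prod.ext (by simp) ?_)
        exact Fin.cons_self_tail y.2.2 }
  have h : ∀ x y : ∀ p, Joint e (Joint (Copies d (a + 1)) (Copies e b')) p,
      ((tensor ρ (tensor (power ρ a) (M (b' + 1)))).submatrix
      (fun x p => f p (x p)) (fun x p => f p (x p))) x y =
      power ρ (a + 1) (fun p => (x p).2.1) (fun p => (y p).2.1) *
        unconsCopy (M (b' + 1)) (fun p => ((x p).1, (x p).2.2))
          (fun p => ((y p).1, (y p).2.2)) := by
    intro x y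
    simp only [f, Matrix.submatrix_apply, Equiv.coe_fn_mk, tensor, power, Matrix.of_apply,
      unconsCopy, Fin.prod_univ_succ, mul_assoc]
  refine ⟨_, IsLOCC.reindex f, ?_, ?_⟩
  · ext x y
    simp only [marginalS, Matrix.of_apply, h, sum_joint]
    rw [Finset.sum_comm]
    simp only [← Finset.sum_mul]
    have := (hρ.power (a + 1)).2
    simp only [Matrix.trace, Matrix.diag_apply] at this
    simp [this]
  · rw [hM']
    ext x y
    simp only [marginalC, Matrix.of_apply, h]
    simp only [tensor, Matrix.of_apply, Finset.mul_sum]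

/-- The step that closes the cycle: the incoming ρ completes the stored `L` copies to `L + 1`, and
only here is `Λ` applied. -/
theorem exists_reset_step {ρ : Op d} {a a' b b' L : ℕ} (ha : a = L) (hb : b = 0) (ha' : a' = 0)
    (hb' : b' = L) {Λ : Op (Copies d (L + 1)) → Op (Copies e (L + 1))} (hΛ : IsLOCC Λ)
    (M : ∀ b, Op (Copies e b)) (hM : IsState (M b)) (hML : M (L + 1) = Λ (power ρ (L + 1)))
    (hM' : M L = marginalC (unconsCopy (M (L + 1)))) :
    ∃ Γ : Op (Joint d (Joint (Copies d a) (Copies e b))) →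
        Op (Joint e (Joint (Copies d a') (Copies e b'))), IsLOCC Γ ∧
      marginalS (Γ (tensor ρ (tensor (power ρ a) (M b)))) =
        marginalS (unconsCopy (M (b' + 1))) ∧
      marginalC (Γ (tensor ρ (tensor (power ρ a) (M b)))) =
        tensor (power ρ a') (M b') := by
  subst ha hb ha' hb'
  let f : ∀ p, Joint d (Copies d b') p ≃ Joint d (Joint (Copies d b') (Copies e 0)) p :=
    fun p => (Equiv.refl (d p)).prodCongr (Equiv.prodUnique _ _).symm
  let g : ∀ p, Joint e (Joint (Copies d 0) (Copies e b')) p ≃ Joint e (Copies e b') p :=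
    fun p => (Equiv.refl (e p)).prodCongr (Equiv.uniqueProd _ _)
  -- Zero copies form a one-dimensional system, whose only state is the scalar 1.
  have hM0 : ∀ x y, M 0 x y = 1 := by
    intro x y
    rw [← hM.2, Subsingleton.elim y x]
    simp only [Matrix.trace, Matrix.diag_apply]
    rw [Fintype.sum_subsingleton _ x]
  have hin : ((tensor ρ (tensor (power ρ b') (M 0))).submatrix
      (fun x p => f p (x p)) (fun x p => f p (x p))) = tensor ρ (power ρ b') := by
    ext x y
    simp [f, tensor, hM0]
  refine ⟨_, (((IsLOCC.reindex f).comp IsLOCC.consCopy).comp hΛ).comp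
    (IsLOCC.unconsCopy.comp (IsLOCC.reindex g)), ?_, ?_⟩
  · simp only [hin, consCopy_tensor_power, ← hML]
    ext x y
    simp only [marginalS, Matrix.of_apply, Matrix.submatrix_apply, sum_joint]
    simp [g]
  · simp only [hin, consCopy_tensor_power, ← hML]
    rw [hM']
    ext x y
    simp [marginalC, g, tensor, power]

theorem exists_catalyst_of_copies (p₀ : Fin N) {ρ : Op d} (hρ : IsState ρ)
    (hne : ∀ p, Nonempty (e p)) {n : ℕ} (hn : 0 < n)
    {Λ : Op (Copies d n) → Op (Copies e n)} (hΛ : IsLOCC Λ) :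
    ∃ (c : Fin N → Type) (_ : ∀ p, Fintype (c p)) (_ : ∀ p, DecidableEq (c p))
      (τ : Op c) (Γ : Op (Joint d c) → Op (Joint e c)), IsState τ ∧ IsLOCC Γ ∧
        marginalS (Γ (tensor ρ τ)) =
          (n : ℂ)⁻¹ • ∑ i, copyMarginal i (Λ (power ρ n)) ∧
        marginalC (Γ (tensor ρ τ)) = τ := by
  obtain ⟨L, rfl⟩ : ∃ L, n = L + 1 := ⟨n - 1, by omega⟩
  obtain ⟨M, hML, hMs, hM, hsum⟩ := exists_tails (hΛ.isState (hρ.power (L + 1)))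
  let V : Fin (L + 1) → Fin N → Type := fun b => Joint (Copies d (L - b)) (Copies e b)
  let T : ∀ b, Op (V b) := fun b => tensor (power ρ (L - b)) (M b)
  have : ∀ p, Nonempty (d p) := fun p => hρ.nonempty p
  let R : Fin (L + 1) → Op e := fun b => marginalS (unconsCopy (M (b + 1)))
  let Step : Fin (L + 1) → Fin (L + 1) → Prop := fun j k =>
    ∃ Γ : Op (Joint d (V j)) → Op (Joint e (V k)), IsLOCC Γ ∧
      marginalS (Γ (tensor ρ (T j))) = R k ∧ marginalC (Γ (tensor ρ (T j))) = T k
  -- The register runs downwards, from `k + 1` to `k`, with 0 going to `L`; hence the permutation is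
  -- the inverse of `finRotate`.
  have hstep : ∀ k, Step (finRotate (L + 1) k) k := by
    intro k
    refine Fin.lastCases ?_ (fun i => ?_) k
    · rw [finRotate_last]
      exact exists_reset_step (by simp) (by simp) (by simp) (by simp) hΛ M
        (hMs _ (Fin.is_lt _).le) hML (hM L (by omega))
    · rw [finRotate_apply, Fin.coeSucc_eq_succ]
      refine exists_shift_step hρ ?_ (by simp) M (hMs _ (Fin.is_lt _).le) (hM _ (Fin.is_lt _))
      have := i.2
      simp only [Fin.val_castSucc, Fin.val_succ]
      omega
  obtain ⟨c, h1, h2, τ, Γ, hτ, hΓ, hS, hC⟩ := exists_cyclic_catalyst p₀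
    (finRotate (L + 1)).symm ρ T (fun b => (hρ.power _).tensor (hMs _ b.2.le)) R
    (fun k => by
      have := hstep ((finRotate (L + 1)).symm k)
      rwa [Equiv.apply_symm_apply] at this)
  refine ⟨c, h1, h2, τ, Γ, hτ, hΓ, ?_, hC⟩
  rw [hS, Fintype.card_fin, ← hsum, Finset.sum_range]

theorem MarginallyReducible.catalyticallyConvertible (p₀ : Fin N) {ρ : Op d} {σ : Op e}
    (hρ : IsState ρ) (hσ : IsState σ) (h : MarginallyReducible ρ σ) :
    CatalyticallyConvertible ρ σ := by
  intro ε hε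
  -- Fewer than `ε / 8 * n` copies are padding, each at distance at most 2 from σ, so padding and
  -- genuine copies each add at most `ε / 4` to the average.
  obtain ⟨m, n, hn, hmn, Λ, hΛ, hclose, hrate⟩ := h (ε / 4) (by linarith) (ε / 8) (by linarith)
  obtain ⟨J, hJ, hpad⟩ := IsLOCC.exists_padding (e := e) hσ.nonempty
  obtain ⟨j, rfl⟩ := Nat.exists_eq_add_of_le hmn
  obtain ⟨Γ, hΓ, hsum⟩ := hpad m j
  obtain ⟨c, h1, h2, τ, Γ', hτ, hΓ', hS, hC⟩ :=
    exists_catalyst_of_copies p₀ hρ hσ.nonempty hn (hΛ.comp hΓ)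
  refine ⟨c, h1, h2, τ, Γ', hτ, hΓ', ?_, hC⟩
  have hμ := hΛ.isState (hρ.power (m + j))
  rw [hS, hsum _ hμ]
  set μ := Λ (power ρ (m + j))
  have hpos : (0 : ℝ) < (m + j : ℕ) := by exact_mod_cast hn
  have hbound : TraceBound ((j : ℝ) * 2 + ∑ i : Fin m, ε / 4)
      (((j : ℝ) : ℂ) • (J - σ) + ∑ i : Fin m, (copyMarginal i μ - σ)) := by
    refine ((TraceBound.sub_of_isState hJ hσ).smul (Nat.cast_nonneg j)).add
      (TraceBound.sum _ fun i _ => ?_)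
    refine (TraceBound.of_traceNorm ?_).mono (hclose i).le
    exact ((IsLOCC.copyMarginal i).posSemidef hμ.1).1.sub hσ.1.1
  have hb := (hbound.smul (inv_nonneg.2 hpos.le)).traceNorm_le
  have heq : ((((m + j : ℕ) : ℝ)⁻¹ : ℝ) : ℂ) •
      (((j : ℝ) : ℂ) • (J - σ) + ∑ i : Fin m, (copyMarginal i μ - σ)) =
      ((m + j : ℕ) : ℂ)⁻¹ • ((j : ℂ) • J + ∑ i, copyMarginal i μ) - σ := by
    have hne : ((m : ℂ) + j) ≠ 0 := by exact_mod_cast hn.ne'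
    have hσ' : σ = ((m : ℂ) + j)⁻¹ • ((j : ℂ) • σ + (m : ℂ) • σ) := by
      rw [← add_smul, smul_smul, add_comm (j : ℂ), inv_mul_cancel₀ hne, one_smul]
    conv_rhs => rw [hσ']
    push_cast
    rw [← smul_sub, Finset.sum_sub_distrib, smul_sub]
    congr 1
    simp only [Finset.sum_const, Finset.card_univ, Fintype.card_fin, ← Nat.cast_smul_eq_nsmul ℂ]
    abel
  rw [heq] at hb
  refine hb.trans_lt ?_
  simp only [Finset.sum_const, Finset.card_univ, Fintype.card_fin, nsmul_eq_mul]
  rw [inv_mul_lt_iff₀ hpos]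
  have h3 : ((m + j : ℕ) : ℝ) < m + ε / 8 * ((m + j : ℕ) : ℝ) := by
    have := mul_lt_mul_of_pos_right hrate hpos
    rwa [one_mul, add_mul, div_mul_cancel₀ _ hpos.ne'] at this
  push_cast at h3 ⊢
  have hm : (0 : ℝ) ≤ m := Nat.cast_nonneg m
  have hj : (0 : ℝ) ≤ j := Nat.cast_nonneg j
  nlinarith

end Reducible

/-! ### Rank-one operators -/

section PureStates

variable {ι κ : Type} [Fintype ι]

/-- The (unnormalised) projector `|φ⟩⟨φ|`. -/
def pureOp (φ : ι → ℂ) : Matrix ι ι ℂ := Matrix.vecMulVec φ (star φ)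

theorem pureOp_apply (φ : ι → ℂ) (x y : ι) : pureOp φ x y = φ x * star (φ y) := rfl

theorem posSemidef_pureOp (φ : ι → ℂ) : (pureOp φ).PosSemidef :=
  Matrix.posSemidef_vecMulVec_self_star φ

theorem trace_pureOp (φ : ι → ℂ) : (pureOp φ).trace = ∑ x, φ x * star (φ x) := rfl

theorem mul_pureOp_mul_conjTranspose (L : Matrix κ ι ℂ) (φ : ι → ℂ) :
    L * pureOp φ * Lᴴ = pureOp (L *ᵥ φ) := by
  rw [pureOp, pureOp, Matrix.mul_vecMulVec, Matrix.vecMulVec_mul, Matrix.star_mulVec]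

theorem pureOp_smul (w : ℂ) (φ : ι → ℂ) : pureOp (w • φ) = (w * star w) • pureOp φ := by
  ext x y
  simp only [pureOp_apply, Pi.smul_apply, Matrix.smul_apply, smul_eq_mul, star_mul']
  ring

end PureStates

/-! ### Pure state transformations branch by branch -/

section Branches

variable {N : ℕ} {d e : Fin N → Type} [∀ p, Fintype (d p)] [∀ p, DecidableEq (d p)]
  [∀ p, Fintype (e p)] [∀ p, DecidableEq (e p)]

/-- A measurement followed by local unitary corrections transforms one pure state into another
if every branch yields a multiple of the target vector. -/
theorem IsLOCC.exists_of_branches {κ : Fin N → Type} [∀ p, Fintype (κ p)]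
    (A : ∀ p, κ p → Matrix (e p) (d p) ℂ) (hA : ∀ p, ∑ j, (A p j)ᴴ * A p j = 1)
    (H : (∀ p, κ p) → ∀ p, Matrix (e p) (e p) ℂ) (hH : ∀ k p, (H k p)ᴴ * H k p = 1)
    {φ : (∀ p, d p) → ℂ} {ψ : (∀ p, e p) → ℂ} (hφ : (pureOp φ).trace = 1)
    (hψ : (pureOp ψ).trace = 1)
    (hbranch : ∀ k, ∃ w : ℂ, localProd (fun p => A p (k p)) *ᵥ φ = w • localProd (H k) *ᵥ ψ) :
    ∃ Λ : Op d → Op e, IsLOCC Λ ∧ Λ (pureOp φ) = pureOp ψ := by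
  choose w hw using hbranch
  have hΓ : ∀ k, IsLOCC fun X : Op e =>
      ∑ _u : (∀ _ : Fin N, Unit), localProd (fun p => (H k p)ᴴ) * X *
        (localProd fun p => (H k p)ᴴ)ᴴ := fun k =>
    IsLOCC.localChannel (κ := fun _ => Unit) (fun p _ => (H k p)ᴴ) fun p => by
      simpa using mul_eq_one_comm.1 (hH k p)
  have hΛ := IsLOCC.round κ (fun p _ => e p) A hA _ hΓ
  refine ⟨_, hΛ, ?_⟩
  -- Trace preservation forces the weights `|w k|²` to sum to 1, so they need not be computed.
  have htr := hΛ.trace (pureOp φ)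
  have hout : ∀ k, localProd (fun p => (H k p)ᴴ) *
      (localProd (fun p => A p (k p)) * pureOp φ * (localProd fun p => A p (k p))ᴴ) *
        (localProd fun p => (H k p)ᴴ)ᴴ = (w k * star (w k)) • pureOp ψ := by
    intro k
    rw [mul_pureOp_mul_conjTranspose, mul_pureOp_mul_conjTranspose, hw, Matrix.mulVec_smul,
      Matrix.mulVec_mulVec, localProd_mul]
    simp only [hH, localProd_one, Matrix.one_mulVec, pureOp_smul]
  simp only [hout, Finset.univ_unique, Finset.sum_singleton, ← Finset.sum_smul] at htr ⊢
  rw [Matrix.trace_smul, hφ, hψ, smul_eq_mul, mul_one] at htr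
  rw [htr, one_smul]

end Branches

/-! ### The singlet network -/

section Singlets

theorem sum_prod_prod {I J T : Type} [Fintype I] [Fintype J] [Fintype T] [DecidableEq I]
    [DecidableEq J] (f : I → J → T → ℂ) :
    ∑ k : I → J → T, ∏ i, ∏ j, f i j (k i j) = ∏ i, ∏ j, ∑ t, f i j t := by
  simp only [Finset.prod_univ_sum, Fintype.piFinset_univ]

variable {N : ℕ}

/-- The vector of the state `pairSinglets N`. -/
noncomputable def pairVec (N : ℕ) (x : ∀ p, PairQubits N p) : ℂ :=
  ∏ pq : {pq : Fin N × Fin N // pq.1 < pq.2},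
    singlet (x pq.1.1 ⟨pq.1.2, pq.2.ne'⟩) (x pq.1.2 ⟨pq.1.1, pq.2.ne⟩)

theorem pairSinglets_eq (N : ℕ) : pairSinglets N = pureOp (pairVec N) := rfl

/-- The qubits of all parties, grouped by pairs of parties. -/
def pairEquiv (N : ℕ) : (∀ p, PairQubits N p) ≃
    ({pq : Fin N × Fin N // pq.1 < pq.2} → Fin 2 × Fin 2) where
  toFun x pq := (x pq.1.1 ⟨pq.1.2, pq.2.ne'⟩, x pq.1.2 ⟨pq.1.1, pq.2.ne⟩)
  invFun g p q := if h : p < q.1 then (g ⟨(p, q.1), h⟩).1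
    else (g ⟨(q.1, p), lt_of_le_of_ne (not_lt.1 h) q.2⟩).2
  left_inv x := by
    funext p q
    by_cases h : p < q.1 <;> simp [h]
  right_inv g := by
    funext pq
    have h : ¬ pq.1.2 < pq.1.1 := not_lt.2 pq.2.le
    simp [h, pq.2]

theorem isState_pairSinglets (N : ℕ) : IsState (pairSinglets N) := by
  refine ⟨posSemidef_pureOp _, ?_⟩
  rw [pairSinglets_eq, trace_pureOp]
  have h1 : ∀ x : ∀ p, PairQubits N p, pairVec N x * star (pairVec N x) =
      ∏ pq, singlet (pairEquiv N x pq).1 (pairEquiv N x pq).2 *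
        star (singlet (pairEquiv N x pq).1 (pairEquiv N x pq).2) := by
    intro x
    rw [Finset.prod_mul_distrib]
    simp [pairVec, pairEquiv]
  have h2 : ∑ t : Fin 2 × Fin 2, singlet t.1 t.2 * star (singlet t.1 t.2) = 1 := by
    have : ((√2 : ℝ) : ℂ) * ((√2 : ℝ) : ℂ) = 2 := by
      rw [← Complex.ofReal_mul, Real.mul_self_sqrt (by norm_num)]
      norm_num
    have hne : ((√2 : ℝ) : ℂ) ≠ 0 := by simp
    simp only [Fintype.sum_prod_type, Fin.sum_univ_two, singlet]
    simp
    field_simp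
    rw [sq, this]
    norm_num
  simp only [h1]
  rw [(pairEquiv N).sum_comp fun g => ∏ pq, singlet (g pq).1 (g pq).2 *
    star (singlet (g pq).1 (g pq).2)]
  have := Finset.prod_univ_sum (fun _ : {pq : Fin N × Fin N // pq.1 < pq.2} =>
    (Finset.univ : Finset (Fin 2 × Fin 2))) fun _ t => singlet t.1 t.2 * star (singlet t.1 t.2)
  rw [Fintype.piFinset_univ] at this
  rw [← this]
  simp only [h2, Finset.prod_const_one]

/-- The vector of `M` copies of `pairSinglets N`. -/
noncomputable def pairVecPow (N M : ℕ) (x : ∀ p, Copies (PairQubits N) M p) : ℂ :=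
  ∏ i, pairVec N fun p => x p i

theorem power_pairSinglets (N M : ℕ) :
    power (pairSinglets N) M = pureOp (pairVecPow N M) := by
  ext x y
  simp [power, pairSinglets_eq, pureOp_apply, pairVecPow, Finset.prod_mul_distrib]

end Singlets

/-! ### Pauli identities behind teleportation -/

section Pauli

/-- The entries of the operators `X^a Z^b` on a qubit. -/
def pauli (k : Fin 2 × Fin 2) (v u : Fin 2) : ℂ :=
  if v = u + k.1 then (if k.2 = 1 ∧ u = 1 then -1 else 1) else 0

/-- The operator that results when one half of a singlet passes through `pauli k`. -/
def pauliSinglet (k : Fin 2 × Fin 2) (v y : Fin 2) : ℂ :=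
  if v = y + 1 + k.1 then (if k.2 = 0 ∧ y = 0 then -1 else 1) else 0

/-- The four operators, read as two-qubit vectors, form an orthogonal basis of vectors of squared
norm 2: the Bell measurement. -/
theorem pauli_completeness (v v' u u' : Fin 2) :
    ∑ k, star (pauli k v u) * pauli k v' u' =
      (if v = v' then 1 else 0) * if u = u' then 2 else 0 := by
  fin_cases v <;> fin_cases v' <;> fin_cases u <;> fin_cases u' <;>
    simp [Fintype.sum_prod_type, Fin.sum_univ_two, pauli] <;> norm_num

theorem pauli_mul_singlet (k : Fin 2 × Fin 2) (v y : Fin 2) :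
    ∑ u, pauli k v u * singlet u y = (1 / (√2 : ℝ) : ℂ) * pauliSinglet k v y := by
  obtain ⟨a, b⟩ := k
  fin_cases a <;> fin_cases b <;> fin_cases v <;> fin_cases y <;>
    simp [Fin.sum_univ_two, pauli, singlet, pauliSinglet] <;> ring

theorem pauliSinglet_unitary (k : Fin 2 × Fin 2) (y y' : Fin 2) :
    ∑ v, star (pauliSinglet k y v) * pauliSinglet k y' v = if y = y' then 1 else 0 := by
  obtain ⟨a, b⟩ := k
  fin_cases a <;> fin_cases b <;> fin_cases y <;> fin_cases y' <;>
    simp [Fin.sum_univ_two, pauliSinglet]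

end Pauli

/-! ### Preparing pure states by teleportation -/

section Preparation

variable {N M : ℕ}

/-- The system consisting of `M` qubits for each party. -/
abbrev Qubits (N M : ℕ) : Fin N → Type := fun _ => Fin M → Fin 2

/-- Basis vectors of all parties, in terms of those of party `p` and those of the others. -/
def senderEquiv (p : Fin N) :
    (Fin M → Fin 2) × Copies (PairQubits N) M p ≃ (∀ p, Qubits N M p) where
  toFun yv q := if h : q ≠ p then fun i => yv.2 i ⟨q, h⟩ else yv.1
  invFun x := (x p, fun i q => x q.1 i)
  left_inv yv := by
    ext i q
    · simp
    · simp [q.2]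
  right_inv x := by
    funext q
    by_cases h : q = p
    · subst h
      simp
    · simp [h]

theorem senderEquiv_self (p : Fin N) (y : Fin M → Fin 2) (v : Copies (PairQubits N) M p) :
    senderEquiv p (y, v) p = y := by simp [senderEquiv]

theorem senderEquiv_ne (p : Fin N) (y : Fin M → Fin 2) (v : Copies (PairQubits N) M p)
    (q : {q : Fin N // q ≠ p}) (i : Fin M) : senderEquiv p (y, v) q.1 i = v i q := by
  simp [senderEquiv, q.2]

theorem prod_prod_ite_eq {I J T : Type} [Fintype I] [Fintype J] [DecidableEq T] [DecidableEq I]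
    [DecidableEq J] (f g : I → J → T) (c : ℂ) :
    ∏ i, ∏ j, (if f i j = g i j then c else 0) =
      if f = g then ∏ _i : I, ∏ _j : J, c else 0 := by
  by_cases h : f = g
  · simp [h]
  · obtain ⟨i, hi⟩ := Function.ne_iff.1 h
    obtain ⟨j, hj⟩ := Function.ne_iff.1 hi
    rw [if_neg h]
    refine Finset.prod_eq_zero (Finset.mem_univ i) (Finset.prod_eq_zero (Finset.mem_univ j) ?_)
    rw [if_neg hj]

/-- The measurement of the party that prepares the state with vector `ψ`: teleportation of the
systems of the others through the halves of maximally entangled pairs that it holds. -/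
noncomputable def sender (ψ : (∀ p, Qubits N M p) → ℂ) (p : Fin N)
    (k : Fin M → {q : Fin N // q ≠ p} → Fin 2 × Fin 2) :
    Matrix (Fin M → Fin 2) (Copies (PairQubits N) M p) ℂ :=
  Matrix.of fun y u => (((∏ _i : Fin M, ∏ _q : {q : Fin N // q ≠ p}, √2 : ℝ) : ℂ))⁻¹ *
    ∑ v : Copies (PairQubits N) M p,
      ψ (senderEquiv p (y, v)) * ∏ i, ∏ q, pauli (k i q) (v i q) (u i q)

/-- Summing over `k`, Bell completeness forces `v = v'` and `u = u'`; its factors 2 cancel the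
squared prefactor, and what remains is the squared norm of ψ. -/
theorem sum_sender {ψ : (∀ p, Qubits N M p) → ℂ} (hψ : (pureOp ψ).trace = 1) (p : Fin N) :
    ∑ k, (sender ψ p k)ᴴ * sender ψ p k = 1 := by
  ext u u'
  have hprod : ∀ v v' : Copies (PairQubits N) M p,
      ∑ k : Fin M → {q : Fin N // q ≠ p} → Fin 2 × Fin 2,
        (∏ i, ∏ q, star (pauli (k i q) (v i q) (u i q))) *
          ∏ i, ∏ q, pauli (k i q) (v' i q) (u' i q) =
      (if v = v' then 1 else 0) * if u = u' then
        (∏ _i : Fin M, ∏ _q : {q : Fin N // q ≠ p}, (2 : ℂ)) else 0 := by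
    intro v v'
    simp only [← Finset.prod_mul_distrib]
    rw [sum_prod_prod fun i q t => star (pauli t (v i q) (u i q)) * pauli t (v' i q) (u' i q)]
    simp only [pauli_completeness, Finset.prod_mul_distrib]
    rw [prod_prod_ite_eq v v' 1, prod_prod_ite_eq u u' 2]
    simp only [Finset.prod_const_one]
  have hc : (((∏ _i : Fin M, ∏ _q : {q : Fin N // q ≠ p}, √2 : ℝ) : ℂ))⁻¹ *
      (((∏ _i : Fin M, ∏ _q : {q : Fin N // q ≠ p}, √2 : ℝ) : ℂ))⁻¹ *
      (∏ _i : Fin M, ∏ _q : {q : Fin N // q ≠ p}, (2 : ℂ)) = 1 := by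
    have h2 : ((√2 : ℝ) : ℂ) * ((√2 : ℝ) : ℂ) = 2 := by
      rw [← Complex.ofReal_mul, Real.mul_self_sqrt (by norm_num)]
      norm_num
    rw [← mul_inv]
    push_cast
    simp only [← Finset.prod_mul_distrib, h2]
    refine inv_mul_cancel₀ ?_
    simp
  set c : ℂ := (((∏ _i : Fin M, ∏ _q : {q : Fin N // q ≠ p}, √2 : ℝ) : ℂ))⁻¹ with hcdef
  have hcstar : star c = c := by
    rw [hcdef, ← Complex.ofReal_inv]
    exact Complex.conj_ofReal _
  have hexp : ∀ (k : Fin M → {q : Fin N // q ≠ p} → Fin 2 × Fin 2) (y : Fin M → Fin 2),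
      star (sender ψ p k y u) * sender ψ p k y u' = ∑ v, ∑ v',
        c * c * (star (ψ (senderEquiv p (y, v))) * ψ (senderEquiv p (y, v'))) *
          ((∏ i, ∏ q, star (pauli (k i q) (v i q) (u i q))) *
          ∏ i, ∏ q, pauli (k i q) (v' i q) (u' i q)) := by
    intro k y
    simp only [sender, Matrix.of_apply, ← hcdef, star_mul', hcstar, star_sum, star_prod]
    rw [mul_mul_mul_comm, Finset.sum_mul_sum, Finset.mul_sum]
    refine Finset.sum_congr rfl fun v _ => ?_
    rw [Finset.mul_sum]
    refine Finset.sum_congr rfl fun v' _ => ?_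
    ring
  simp only [Matrix.sum_apply, Matrix.mul_apply, Matrix.conjTranspose_apply, hexp]
  rw [Finset.sum_comm]
  have hk : ∀ y : Fin M → Fin 2, ∑ k : Fin M → {q : Fin N // q ≠ p} → Fin 2 × Fin 2,
      ∑ v, ∑ v',
        c * c * (star (ψ (senderEquiv p (y, v))) * ψ (senderEquiv p (y, v'))) *
          ((∏ i, ∏ q, star (pauli (k i q) (v i q) (u i q))) *
          ∏ i, ∏ q, pauli (k i q) (v' i q) (u' i q)) =
      (if u = u' then 1 else 0) * ∑ v, ψ (senderEquiv p (y, v)) *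
        star (ψ (senderEquiv p (y, v))) := by
    intro y
    rw [Finset.sum_comm, Finset.mul_sum]
    refine Finset.sum_congr rfl fun v _ => ?_
    rw [Finset.sum_comm]
    simp only [← Finset.mul_sum, hprod]
    rw [Finset.sum_eq_single v]
    · by_cases h : u = u'
      · simp only [h, if_true, one_mul]
        rw [mul_right_comm, hc, one_mul, mul_comm]
      · simp [h]
    · intro v' _ h
      simp [h.symm]
    · simp
  simp only [hk]
  rw [← Finset.mul_sum, ← Fintype.sum_prod_type'
    (f := fun y v => ψ (senderEquiv p (y, v)) * star (ψ (senderEquiv p (y, v)))),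
    (senderEquiv p).sum_comp fun x => ψ x * star (ψ x), ← trace_pureOp, hψ, mul_one,
    Matrix.one_apply]

/-- The qubits of party `p` in terms of those that it shares with `p₀` and the other ones. -/
def glue (p₀ p : Fin N) (z : Fin M → {q : Fin N // q ≠ p ∧ q ≠ p₀} → Fin 2)
    (y : Fin M → Fin 2) : Copies (PairQubits N) M p :=
  fun i q => if h : q.1 = p₀ then y i else z i ⟨q.1, q.2, h⟩

/-- A measurement, in the computational basis, of the qubits not shared with `p₀`. -/
def receiver (p₀ p : Fin N) (z : Fin M → {q : Fin N // q ≠ p ∧ q ≠ p₀} → Fin 2) :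
    Matrix (Fin M → Fin 2) (Copies (PairQubits N) M p) ℂ :=
  Matrix.of fun y x => if x = glue p₀ p z y then 1 else 0

/-- Every basis vector is `glue p₀ p z y` for exactly one pair `(z, y)`. -/
theorem sum_receiver {p₀ p : Fin N} (hp : p ≠ p₀) :
    ∑ z : Fin M → {q : Fin N // q ≠ p ∧ q ≠ p₀} → Fin 2,
      (receiver p₀ p z)ᴴ * receiver p₀ p z = 1 := by
  ext x x'
  have hiff : ∀ (x : Copies (PairQubits N) M p) z y, x = glue p₀ p z y ↔
      z = (fun i q => x i ⟨q.1, q.2.1⟩) ∧ y = fun i => x i ⟨p₀, hp.symm⟩ := by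
    intro x z y
    constructor
    · rintro rfl
      refine ⟨?_, ?_⟩
      · funext i q
        simp [glue, q.2.2]
      · funext i
        simp [glue]
    · rintro ⟨rfl, rfl⟩
      funext i q
      by_cases h : q.1 = p₀
      · obtain ⟨q, hq⟩ := q
        subst h
        simp [glue]
      · simp [glue, h]
  simp only [Matrix.sum_apply, Matrix.mul_apply, Matrix.conjTranspose_apply, receiver,
    Matrix.of_apply, Matrix.one_apply]
  rw [Finset.sum_eq_single (fun i q => x i ⟨q.1, q.2.1⟩),
    Finset.sum_eq_single (fun i => x i ⟨p₀, hp.symm⟩)]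
  · rw [if_pos ((hiff x _ _).2 ⟨rfl, rfl⟩), ← (hiff x _ _).2 ⟨rfl, rfl⟩]
    simp [eq_comm]
  · intro y _ h
    rw [if_neg fun h' => h ((hiff x _ _).1 h').2]
    simp
  · simp
  · intro z _ h
    refine Finset.sum_eq_zero fun y _ => ?_
    rw [if_neg fun h' => h ((hiff x _ _).1 h').1]
    simp
  · simp

/-- The distortion of the systems of the others in the branch `k` of the measurement of `p₀`. -/
def distortion (p₀ : Fin N) (k : Fin M → {q : Fin N // q ≠ p₀} → Fin 2 × Fin 2) (p : Fin N) :
    Matrix (Fin M → Fin 2) (Fin M → Fin 2) ℂ :=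
  if h : p ≠ p₀ then Matrix.of fun y x => ∏ i, pauliSinglet (k i ⟨p, h⟩) (x i) (y i) else 1

theorem distortion_unitary (p₀ : Fin N) (k : Fin M → {q : Fin N // q ≠ p₀} → Fin 2 × Fin 2)
    (p : Fin N) : (distortion p₀ k p)ᴴ * distortion p₀ k p = 1 := by
  by_cases h : p ≠ p₀
  · ext x x'
    simp only [distortion, dif_pos h, Matrix.mul_apply, Matrix.conjTranspose_apply,
      Matrix.of_apply, star_prod, ← Finset.prod_mul_distrib]
    have := Finset.prod_univ_sum (fun _ : Fin M => (Finset.univ : Finset (Fin 2)))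
      fun i t => star (pauliSinglet (k i ⟨p, h⟩) (x i) t) * pauliSinglet (k i ⟨p, h⟩) (x' i) t
    rw [Fintype.piFinset_univ] at this
    rw [← this]
    simp only [pauliSinglet_unitary, Finset.prod_ite_zero, Matrix.one_apply, funext_iff]
    simp
  · simp [distortion, h]

theorem localProd_distortion_mulVec (p₀ : Fin N)
    (k : Fin M → {q : Fin N // q ≠ p₀} → Fin 2 × Fin 2) (ψ : (∀ p, Qubits N M p) → ℂ)
    (y : ∀ p, Qubits N M p) :
    (localProd (distortion p₀ k) *ᵥ ψ) y = ∑ v : Copies (PairQubits N) M p₀,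
      ψ (senderEquiv p₀ (y p₀, v)) * ∏ i, ∏ q : {q : Fin N // q ≠ p₀},
        pauliSinglet (k i q) (v i q) (y q i) := by
  simp only [Matrix.mulVec, dotProduct]
  rw [← (senderEquiv p₀).sum_comp, Fintype.sum_prod_type, Finset.sum_eq_single (y p₀)]
  · refine Finset.sum_congr rfl fun v _ => ?_
    rw [mul_comm, localProd_apply, Fintype.prod_eq_mul_prod_subtype_ne _ p₀, Finset.prod_comm]
    congr 1
    have h0 : distortion p₀ k p₀ (y p₀) (senderEquiv p₀ (y p₀, v) p₀) = 1 := by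
      rw [senderEquiv_self]
      simp [distortion]
    rw [h0, one_mul]
    refine Finset.prod_congr rfl fun q _ => ?_
    simp [distortion, senderEquiv_ne, q.2]
  · intro y' _ h
    refine Finset.sum_eq_zero fun v _ => ?_
    rw [localProd_apply, Fintype.prod_eq_mul_prod_subtype_ne _ p₀]
    have h0 : distortion p₀ k p₀ (y p₀) (senderEquiv p₀ (y', v) p₀) = 0 := by
      rw [senderEquiv_self]
      simp [distortion, h.symm]
    rw [h0, zero_mul, zero_mul]
  · simp

/-- Teleportation: contracting each Pauli with its singlet carries the qubit to its receiver up to a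
unitary known from `k`. The factor `w` does not depend on `y`, so the branch is proportional to the
distorted target. -/
theorem sender_mul_singlets (ψ : (∀ p, Qubits N M p) → ℂ) (p₀ : Fin N)
    (k : Fin M → {q : Fin N // q ≠ p₀} → Fin 2 × Fin 2) :
    ∃ w : ℂ, ∀ y : ∀ p, Qubits N M p, ∑ u, sender ψ p₀ k (y p₀) u *
      ∏ i, ∏ q : {q : Fin N // q ≠ p₀}, singlet (u i q) (y q i) =
        w * (localProd (distortion p₀ k) *ᵥ ψ) y := by
  refine ⟨(((∏ _i : Fin M, ∏ _q : {q : Fin N // q ≠ p₀}, √2 : ℝ) : ℂ))⁻¹ *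
    ∏ _i : Fin M, ∏ _q : {q : Fin N // q ≠ p₀}, (1 / (√2 : ℝ) : ℂ), fun y => ?_⟩
  rw [localProd_distortion_mulVec]
  simp only [sender, Matrix.of_apply, Finset.mul_sum, Finset.sum_mul]
  rw [Finset.sum_comm]
  refine Finset.sum_congr rfl fun v _ => ?_
  have h : ∑ u : Copies (PairQubits N) M p₀, ((∏ i, ∏ q, pauli (k i q) (v i q) (u i q)) *
      ∏ i, ∏ q : {q : Fin N // q ≠ p₀}, singlet (u i q) (y q i)) =
      (∏ _i : Fin M, ∏ _q : {q : Fin N // q ≠ p₀}, (1 / (√2 : ℝ) : ℂ)) *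
        ∏ i, ∏ q : {q : Fin N // q ≠ p₀}, pauliSinglet (k i q) (v i q) (y q i) := by
    simp only [← Finset.prod_mul_distrib, ← pauli_mul_singlet]
    exact sum_prod_prod fun i q t => pauli (k i q) (v i q) t * singlet t (y q i)
  rw [mul_assoc, mul_left_comm (∏ _i : Fin M, ∏ _q : {q : Fin N // q ≠ p₀}, (1 / (√2 : ℝ) : ℂ)),
    ← h, ← mul_assoc, Finset.mul_sum]
  refine Finset.sum_congr rfl fun u _ => ?_
  ring

/-- Once the receivers' outcomes `z` are fixed, singlets not involving `p₀` contribute a constant.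
As `p₀` is the least party, it always holds the first qubit of its singlets, so no signs arise. -/
theorem pairVecPow_eq {p₀ : Fin N} (hp₀ : ∀ q, p₀ ≤ q)
    (z : ∀ p, Fin M → {q : Fin N // q ≠ p ∧ q ≠ p₀} → Fin 2) :
    ∃ r : ℂ, ∀ (u : Copies (PairQubits N) M p₀) (y : ∀ p, Qubits N M p),
      pairVecPow N M (Function.update (fun p => glue p₀ p (z p) (y p)) p₀ u) =
        r * ∏ i, ∏ q : {q : Fin N // q ≠ p₀}, singlet (u i q) (y q i) := by
  -- The argument 0 of `glue` is a dummy: these pairs avoid `p₀`, so only `z` is read.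
  refine ⟨∏ i, ∏ pq : {pq : Fin N × Fin N // pq.1 < pq.2} with pq.1.1 ≠ p₀,
    singlet (glue p₀ pq.1.1 (z pq.1.1) 0 i ⟨pq.1.2, pq.2.ne'⟩)
      (glue p₀ pq.1.2 (z pq.1.2) 0 i ⟨pq.1.1, pq.2.ne⟩), fun u y => ?_⟩
  rw [pairVecPow, ← Finset.prod_mul_distrib]
  refine Finset.prod_congr rfl fun i _ => ?_
  rw [pairVec, ← Finset.prod_filter_mul_prod_filter_not Finset.univ
    (fun pq : {pq : Fin N × Fin N // pq.1 < pq.2} => pq.1.1 ≠ p₀)]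
  congr 1
  · refine Finset.prod_congr rfl fun pq hpq => ?_
    have h1 : pq.1.1 ≠ p₀ := (Finset.mem_filter.1 hpq).2
    have h2 : pq.1.2 ≠ p₀ := ((hp₀ pq.1.1).trans_lt pq.2).ne'
    simp [glue, h1, h2]
  · refine Finset.prod_bij' (fun pq hpq => ⟨pq.1.2, ((hp₀ pq.1.1).trans_lt pq.2).ne'⟩)
      (fun q _ => ⟨(p₀, q.1), lt_of_le_of_ne (hp₀ q.1) q.2.symm⟩) (by simp) (by simp) ?_ ?_ ?_
    · rintro ⟨⟨p, q⟩, h⟩ hpq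
      obtain rfl : p = p₀ := by simpa using hpq
      rfl
    · intro q _
      rfl
    · rintro ⟨⟨p, q⟩, h⟩ hpq
      obtain rfl : p = p₀ := by simpa using hpq
      simp [Function.update_of_ne h.ne', glue]

theorem exists_prepare_pure {p₀ : Fin N} (hp₀ : ∀ q, p₀ ≤ q) {ψ : (∀ p, Qubits N M p) → ℂ}
    (hψ : (pureOp ψ).trace = 1) :
    ∃ Λ : Op (Copies (PairQubits N) M) → Op (Qubits N M), IsLOCC Λ ∧
      Λ (power (pairSinglets N) M) = pureOp ψ := by
  -- A common outcome type for sender and receivers; outcomes of the wrong role get Kraus operator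
  -- 0, and such branches satisfy the branch condition with weight 0.
  let κ : Fin N → Type := fun p => (Fin M → {q : Fin N // q ≠ p ∧ q ≠ p₀} → Fin 2) ⊕
    (Fin M → {q : Fin N // q ≠ p} → Fin 2 × Fin 2)
  let A : ∀ p, κ p → Matrix (Qubits N M p) (Copies (PairQubits N) M p) ℂ := fun p =>
    if p = p₀ then Sum.elim (fun _ => 0) (sender ψ p) else Sum.elim (receiver p₀ p) fun _ => 0
  have hA : ∀ p, ∑ j, (A p j)ᴴ * A p j = 1 := by
    intro p
    simp only [κ, Fintype.sum_sum_type]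
    by_cases h : p = p₀
    · simp [A, h, sum_sender hψ]
    · simp [A, h, sum_receiver h]
  let H : (∀ p, κ p) → ∀ p, Matrix (Qubits N M p) (Qubits N M p) ℂ := fun k =>
    distortion p₀ (Sum.elim (fun _ _ _ => (0, 0)) id (k p₀))
  rw [power_pairSinglets]
  refine IsLOCC.exists_of_branches A hA H (fun k p => distortion_unitary _ _ p) ?_ hψ fun k => ?_
  · rw [← power_pairSinglets]
    exact ((isState_pairSinglets N).power M).2
  by_cases hzero : ∃ p, A p (k p) = 0
  · obtain ⟨p, hp⟩ := hzero
    have : localProd (fun p => A p (k p)) = 0 := by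
      ext y x
      refine Finset.prod_eq_zero (Finset.mem_univ p) ?_
      change A p (k p) (y p) (x p) = 0
      rw [hp]
      rfl
    exact ⟨0, by rw [this]; simp⟩
  push Not at hzero
  obtain ⟨K, hK⟩ : ∃ K, k p₀ = Sum.inr K := by
    have := hzero p₀
    rcases h : k p₀ with z | K
    · rw [h] at this
      simp [A] at this
    · exact ⟨K, rfl⟩
  have hz : ∀ p, ∃ z, p ≠ p₀ → k p = Sum.inl z := by
    intro p
    by_cases hp : p = p₀
    · exact ⟨fun _ _ => 0, fun h => absurd hp h⟩
    · have := hzero p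
      rcases h : k p with z | K
      · exact ⟨z, fun _ => rfl⟩
      · rw [h] at this
        simp [A, hp] at this
  choose z hz using hz
  obtain ⟨w, hw⟩ := sender_mul_singlets ψ p₀ K
  obtain ⟨r, hr⟩ := pairVecPow_eq (M := M) hp₀ z
  refine ⟨r * w, ?_⟩
  funext y
  have hH : H k = distortion p₀ K := by simp [H, hK]
  have hA₀ : A p₀ (k p₀) = sender ψ p₀ K := by simp [A, hK]
  have hAp : ∀ p, p ≠ p₀ → A p (k p) = receiver p₀ p (z p) := fun p hp => by
    simp [A, hp, hz p hp]
  rw [hH, Pi.smul_apply, smul_eq_mul, mul_assoc, ← hw, Finset.mul_sum]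
  simp only [Matrix.mulVec, dotProduct]
  symm
  refine Fintype.sum_of_injective
    (fun u => Function.update (fun p => glue p₀ p (z p) (y p)) p₀ u)
    (Function.update_injective _ _) _ _ (fun x hx => ?_) fun u => ?_
  · have : ∃ p, p ≠ p₀ ∧ x p ≠ glue p₀ p (z p) (y p) := by
      by_contra! h
      refine hx ⟨x p₀, ?_⟩
      funext p
      by_cases hp : p = p₀
      · subst hp
        simp
      · simp [hp, h p hp]
    obtain ⟨p, hp, hxp⟩ := this
    rw [localProd_apply, Finset.prod_eq_zero (Finset.mem_univ p), zero_mul]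
    simp [hAp p hp, receiver, hxp]
  · have h1 : localProd (fun p => A p (k p)) y
        (Function.update (fun p => glue p₀ p (z p) (y p)) p₀ u) = sender ψ p₀ K (y p₀) u := by
      rw [localProd_apply, Fintype.prod_eq_mul_prod_subtype_ne _ p₀, hA₀,
        Finset.prod_eq_one fun p _ => ?_, mul_one, Function.update_self]
      rw [hAp p.1 p.2]
      simp [receiver, p.2]
    rw [hr, h1]
    ring

end Preparation

/-! ### Preparing mixed states -/

section Mixed

variable {N : ℕ} {c : Fin N → Type} [∀ p, Fintype (c p)] [∀ p, DecidableEq (c p)]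

/-- Every state can be prepared from sufficiently many singlets between all pairs of parties. -/
theorem exists_prepare {p₀ : Fin N} (hp₀ : ∀ q, p₀ ≤ q) {τ : Op c} (hτ : IsState τ) :
    ∃ (M : ℕ) (Λ : Op (Copies (PairQubits N) M) → Op c), IsLOCC Λ ∧
      Λ (power (pairSinglets N) M) = τ := by
  classical
  -- The rows of `B` give a purification: amplitude `star (B j a)` on `a`, with the label `j` copied
  -- to every party. Discarding the labels returns `Bᴴ * B`.
  obtain ⟨B, rfl⟩ : ∃ B : Op c, τ = Bᴴ * B := by
    open scoped MatrixOrder in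
    have h := Matrix.nonneg_iff_posSemidef.2 hτ.1
    exact CStarAlgebra.nonneg_iff_eq_star_mul_self.1 h
  have : ∀ p, Nonempty (c p) := hτ.nonempty
  let J := ∀ p, c p
  let M := ∑ p, Fintype.card (c p × J)
  have hg : ∀ p, Nonempty (c p × J ↪ (Fin M → Fin 2)) := by
    intro p
    refine Function.Embedding.nonempty_of_card_le ?_
    have h1 : Fintype.card (c p × J) ≤ M :=
      Finset.single_le_sum (f := fun p => Fintype.card (c p × J)) (fun _ _ => Nat.zero_le _)
        (Finset.mem_univ p)
    rw [Fintype.card_fun, Fintype.card_fin, Fintype.card_fin]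
    exact h1.trans Nat.lt_two_pow_self.le
  let g : ∀ p, c p × J ↪ (Fin M → Fin 2) := fun p => (hg p).some
  -- Decoding must be an isometry on all of the qubit space, so bit strings outside the code are
  -- kept distinct under `Sum.inr`.
  have hf : ∀ p, ∃ f : (Fin M → Fin 2) → c p × (J ⊕ (Fin M → Fin 2)), f.Injective ∧
      ∀ a j, f (g p (a, j)) = (a, Sum.inl j) := by
    intro p
    refine ⟨fun u => if h : ∃ aj, g p aj = u then (h.choose.1, Sum.inl h.choose.2)
      else (Classical.arbitrary _, Sum.inr u), fun u u' huu => ?_, fun a j => ?_⟩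
    · by_cases h : ∃ aj, g p aj = u <;> by_cases h' : ∃ aj, g p aj = u'
      · simp only [h, h', dif_pos, Prod.mk.injEq, Sum.inl.injEq] at huu
        rw [← h.choose_spec, ← h'.choose_spec, Prod.ext huu.1 huu.2]
      · simp [h, h'] at huu
      · simp [h, h'] at huu
      · simpa [h, h'] using huu
    · have h : ∃ aj, g p aj = g p (a, j) := ⟨_, rfl⟩
      have h' : h.choose = (a, j) := (g p).injective h.choose_spec
      simp only [h, dif_pos, h']
  choose f hfinj hfg using hf
  let E : J × J → ∀ p, Qubits N M p := fun aj p => g p (aj.1 p, aj.2)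
  have hE : E.Injective := by
    rintro ⟨a, j⟩ ⟨a', j'⟩ h
    have h' : ∀ p, (a p, j) = (a' p, j') := fun p => (g p).injective (congrFun h p)
    refine Prod.ext (funext fun p => (Prod.ext_iff.1 (h' p)).1) (Prod.ext_iff.1 (h' p₀)).2
  let ψ : (∀ p, Qubits N M p) → ℂ := Function.extend E (fun aj => star (B aj.2 aj.1)) 0
  have hψE : ∀ a j, ψ (E (a, j)) = star (B j a) := fun a j => hE.extend_apply _ _ (a, j)
  have hψ0 : ∀ x, x ∉ Set.range E → ψ x = 0 := fun x hx => Function.extend_apply' _ _ _ hx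
  have hψ : (pureOp ψ).trace = 1 := by
    rw [← hτ.2, trace_pureOp]
    symm
    have : (Bᴴ * B).trace = ∑ aj : J × J, star (B aj.2 aj.1) * B aj.2 aj.1 := by
      simp only [Matrix.trace, Matrix.diag_apply, Matrix.mul_apply, Matrix.conjTranspose_apply,
        Fintype.sum_prod_type]
      rfl
    rw [this]
    refine Fintype.sum_of_injective E hE _ _ (fun x hx => ?_) fun aj => ?_
    · rw [hψ0 x hx, zero_mul]
    · rw [hψE, star_star]
  obtain ⟨Λ, hΛ, hΛψ⟩ := exists_prepare_pure hp₀ hψ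
  have hF : ∀ (x : ∀ p, c p) (k : ∀ p : Fin N, J ⊕ (Fin M → Fin 2)),
      (basisMap f *ᵥ ψ) (fun p => (x p, k p)) =
        ∑ j : J, if k = fun _ => Sum.inl j then star (B j x) else 0 := by
    intro x k
    simp only [Matrix.mulVec, dotProduct, basisMap, Matrix.of_apply]
    symm
    refine Fintype.sum_of_injective (fun j => E (x, j))
      (fun j j' h => congrArg Prod.snd (hE h)) _ _ (fun u hu => ?_) fun j => ?_
    · by_cases hr : u ∈ Set.range E
      · obtain ⟨⟨a, j⟩, rfl⟩ := hr
        rw [if_neg, zero_mul]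
        intro h
        refine hu ⟨j, ?_⟩
        have : x = a := funext fun p => by
          have := congrFun h p
          rw [hfg] at this
          exact congrArg Prod.fst this
        rw [this]
      · rw [hψ0 u hr, mul_zero]
    · rw [hψE]
      have : ((fun p => (x p, k p)) = fun p => f p (E (x, j) p)) ↔ k = fun _ => Sum.inl j := by
        simp only [E, hfg, funext_iff, Prod.mk.injEq, true_and]
      simp only [this, ite_mul, one_mul, zero_mul]
  refine ⟨M, _, (hΛ.comp (IsLOCC.embed (d := Qubits N M)
    (e := Joint c fun _ => J ⊕ (Fin M → Fin 2)) hfinj)).comp (IsLOCC.marginalS _ _), ?_⟩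
  rw [hΛψ, embed, mul_pureOp_mul_conjTranspose]
  ext x y
  simp only [marginalS, Matrix.of_apply, pureOp_apply, hF, Matrix.mul_apply,
    Matrix.conjTranspose_apply]
  symm
  refine Fintype.sum_of_injective (fun (j : J) (_ : Fin N) => Sum.inl j)
    (fun j j' h => Sum.inl_injective (congrFun h p₀)) _ _ (fun k hk => ?_) fun j => ?_
  · rw [Finset.sum_eq_zero, zero_mul]
    intro j _
    rw [if_neg fun h => hk ⟨j, h.symm⟩]
  · have : ∀ x, (∑ j' : J, if (fun _ : Fin N => (Sum.inl j : J ⊕ (Fin M → Fin 2))) =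
        fun _ => Sum.inl j' then star (B j' x) else 0) = star (B j x) := by
      intro x
      rw [Finset.sum_eq_single j, if_pos rfl]
      · intro j' _ h
        rw [if_neg]
        intro h'
        have h₀ : (Sum.inl j : J ⊕ (Fin M → Fin 2)) = Sum.inl j' := congrFun h' p₀
        exact h (Sum.inl_injective h₀).symm
      · simp
    rw [this, this, star_star]

end Mixed

/-! ### Protocols in parallel -/

section Parallel

variable {N : ℕ} {d e c f : Fin N → Type} [∀ p, Fintype (d p)] [∀ p, DecidableEq (d p)]
  [∀ p, Fintype (e p)] [∀ p, DecidableEq (e p)] [∀ p, Fintype (c p)] [∀ p, DecidableEq (c p)]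
  [∀ p, Fintype (f p)] [∀ p, DecidableEq (f p)]

theorem swap_tensor (ρ : Op d) (τ : Op c) : swap (tensor ρ τ) = tensor τ ρ := by
  ext x y
  simp [swap, tensor, mul_comm]

theorem TraceBound.tensor_left {b : ℝ} {X : Op d} (h : TraceBound b X) {τ : Op c}
    (hτ : IsState τ) : TraceBound b (tensor τ X) := by
  rw [← swap_tensor]
  exact IsLOCC.swap.traceBound (h.tensor_right hτ)

theorem TraceBound.tensor_sub_tensor {a b : ℝ} {X X' : Op d} {Y Y' : Op c}
    (h : TraceBound a (X - X')) (h' : TraceBound b (Y - Y')) (hY : IsState Y)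
    (hX' : IsState X') : TraceBound (a + b) (tensor X Y - tensor X' Y') := by
  convert (h.tensor_right hY).add (h'.tensor_left hX') using 1
  ext x y
  simp only [tensor, Matrix.sub_apply, Matrix.add_apply, Matrix.of_apply]
  ring

theorem IsLOCC.exists_tensor {Λ : Op d → Op e} (hΛ : IsLOCC Λ) {Γ : Op c → Op f}
    (hΓ : IsLOCC Γ) : ∃ Θ : Op (Joint d c) → Op (Joint e f), IsLOCC Θ ∧
      ∀ ρ τ, Θ (tensor ρ τ) = tensor (Λ ρ) (Γ τ) := by
  refine ⟨_, (((hΛ.ampl c).comp IsLOCC.swap).comp (hΓ.ampl e)).comp IsLOCC.swap, fun ρ τ => ?_⟩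
  simp only [ampl_tensor hΛ.isLinearMap, swap_tensor, ampl_tensor hΓ.isLinearMap]

/-- Splitting `m + n` copies of a system into `m` copies and `n` copies. -/
theorem IsLOCC.exists_splitCopies (ρ : Op d) (m n : ℕ) :
    ∃ Λ : Op (Copies d (m + n)) → Op (Joint (Copies d m) (Copies d n)), IsLOCC Λ ∧
      Λ (power ρ (m + n)) = tensor (power ρ m) (power ρ n) := by
  refine ⟨_, IsLOCC.reindex (d := Copies d (m + n)) (e := Joint (Copies d m) (Copies d n))
    fun p => Fin.appendEquiv m n, ?_⟩
  ext x y
  simp [power, tensor, Fin.prod_univ_add]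

end Parallel

/-! ### From correlated catalysis to marginal reducibility -/

section Catalytic

variable {N : ℕ} {d e c : Fin N → Type} [∀ p, Fintype (d p)] [∀ p, DecidableEq (d p)]
  [∀ p, Fintype (e p)] [∀ p, DecidableEq (e p)] [∀ p, Fintype (c p)] [∀ p, DecidableEq (c p)]

theorem Distillable.exists_pairSinglets {ρ : Op d} (hρ : IsState ρ) (h : Distillable ρ) {ε : ℝ}
    (hε : 0 < ε) : ∃ (n : ℕ) (Λ : Op (Copies d n) → Op (PairQubits N)), IsLOCC Λ ∧
      TraceBound ε (Λ (power ρ n) - pairSinglets N) := by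
  obtain ⟨r, hr, h⟩ := h
  -- With slack `r / 2` the rate stays positive, so at least one copy is produced; the first one is
  -- kept.
  obtain ⟨m, n, hn, Λ, hΛ, hclose, hrate⟩ := h ε hε (r / 2) (by linarith)
  obtain ⟨m, rfl⟩ : ∃ k, m = k + 1 := by
    refine ⟨m - 1, ?_⟩
    have : m ≠ 0 := by
      rintro rfl
      simp only [Nat.cast_zero, zero_div, zero_add] at hrate
      linarith
    omega
  have hΓ := (IsLOCC.unconsCopy (d := PairQubits N) (n := m)).comp (IsLOCC.marginalS _ _)
  refine ⟨n, _, hΛ.comp hΓ, ?_⟩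
  have hΦ := isState_pairSinglets N
  have h1 : TraceBound ε (Λ (power ρ n) - power (pairSinglets N) (m + 1)) :=
    (TraceBound.of_traceNorm ((hΛ.posSemidef (hρ.power n).1).1.sub
      (hΦ.power (m + 1)).1.1)).mono hclose.le
  have h2 := hΓ.traceBound h1
  rw [hΓ.isLinearMap.map_sub] at h2
  rwa [unconsCopy_power, marginalS_tensor, (hΦ.power m).2, one_smul] at h2

/-- Independent blocks of copies of ρ yield one network each, and their errors add up. The rate
plays no role for a fixed `M`. -/
theorem Distillable.exists_power_pairSinglets {ρ : Op d} (hρ : IsState ρ) (h : Distillable ρ)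
    (M : ℕ) {ε : ℝ} (hε : 0 < ε) :
    ∃ (n : ℕ) (Λ : Op (Copies d n) → Op (Copies (PairQubits N) M)), IsLOCC Λ ∧
      TraceBound ε (Λ (power ρ n) - power (pairSinglets N) M) := by
  induction M generalizing ε with
  | zero =>
    refine ⟨0, _, IsLOCC.reindex (d := Copies d 0) (e := Copies (PairQubits N) 0)
      fun p => Equiv.ofUnique _ _, ?_⟩
    convert (TraceBound.zero (ι := ∀ p, Copies (PairQubits N) 0 p)).mono hε.le using 1
    ext x y
    simp [power]
  | succ M ih =>
    obtain ⟨m, Λ, hΛ, hm⟩ := h.exists_pairSinglets hρ (half_pos hε)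
    obtain ⟨n, Γ, hΓ, hn⟩ := ih (half_pos hε)
    obtain ⟨Δ, hΔ, hsplit⟩ := IsLOCC.exists_splitCopies ρ m n
    obtain ⟨Θ, hΘ, htensor⟩ := hΛ.exists_tensor hΓ
    refine ⟨m + n, _, (hΔ.comp hΘ).comp IsLOCC.consCopy, ?_⟩
    rw [hsplit, htensor, ← consCopy_tensor_power, ← IsLOCC.consCopy.isLinearMap.map_sub]
    refine IsLOCC.consCopy.traceBound ?_
    rw [← add_halves ε]
    exact hm.tensor_sub_tensor hn (hΓ.isState (hρ.power n)) (isState_pairSinglets N)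

theorem Distillable.exists_approx {p₀ : Fin N} (hp₀ : ∀ q, p₀ ≤ q) {ρ : Op d} (hρ : IsState ρ)
    (h : Distillable ρ) {τ : Op c} (hτ : IsState τ) {ε : ℝ} (hε : 0 < ε) :
    ∃ (n : ℕ) (Λ : Op (Copies d n) → Op c), IsLOCC Λ ∧ TraceBound ε (Λ (power ρ n) - τ) := by
  obtain ⟨M, Γ, hΓ, hτ'⟩ := exists_prepare hp₀ hτ
  obtain ⟨n, Λ, hΛ, hn⟩ := h.exists_power_pairSinglets hρ M hε
  refine ⟨n, _, hΛ.comp hΓ, ?_⟩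
  rw [← hτ', ← hΓ.isLinearMap.map_sub]
  exact hΓ.traceBound hn

/-- One catalyst can be used for `t` copies in succession. -/
theorem exists_iterate_catalysis {ρ : Op d} (hρ : IsState ρ) {τ : Op c}
    {Λ : Op (Joint d c) → Op (Joint e c)} (hΛ : IsLOCC Λ)
    (hcat : marginalC (Λ (tensor ρ τ)) = τ) (t : ℕ) :
    ∃ Ψ : Op (Joint (Copies d t) c) → Op (Copies e t), IsLOCC Ψ ∧
      ∀ i, copyMarginal i (Ψ (tensor (power ρ t) τ)) = marginalS (Λ (tensor ρ τ)) := by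
  induction t with
  | zero =>
    obtain ⟨Ψ, hΨ⟩ := IsLOCC.exists_of_nonempty (Joint (Copies d 0) c) (Copies e 0)
    exact ⟨Ψ, hΨ, fun i => i.elim0⟩
  | succ t ih =>
    obtain ⟨Ψ, hΨ, hmarg⟩ := ih
    let f : ∀ p, Joint (Joint d c) (Copies d t) p ≃ Joint (Copies d (t + 1)) c p := fun p =>
      { toFun x := (Fin.cons x.1.1 x.2, x.1.2)
        invFun y := ((y.1 0, y.2), fun i => y.1 i.succ)
        left_inv x := by simp
        right_inv y := Prod.ext (Fin.cons_self_tail y.1) rfl }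
    let g : ∀ p, Joint (Joint (Copies d t) c) e p ≃ Joint (Joint e c) (Copies d t) p := fun p =>
      { toFun x := ((x.2, x.1.2), x.1.1)
        invFun y := ((y.2, y.1.2), y.1.1)
        left_inv x := rfl
        right_inv y := rfl }
    have h1 : (tensor (power ρ (t + 1)) τ).submatrix (fun x p => f p (x p))
        (fun x p => f p (x p)) = tensor (tensor ρ τ) (power ρ t) := by
      ext x y
      simp only [f, Matrix.submatrix_apply, Equiv.coe_fn_mk, tensor, power, Matrix.of_apply,
        Fin.prod_univ_succ, Fin.cons_zero, Fin.cons_succ]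
      ring
    set X := Λ (tensor ρ τ) with hX
    set Y : Op (Joint (Joint (Copies d t) c) e) := (tensor X (power ρ t)).submatrix
      (fun x p => g p (x p)) (fun x p => g p (x p)) with hY
    -- After the first use, the remaining copies and the catalyst are again in the ideal product
    -- state once the output is ignored. This is where exact recovery of τ enters, and it makes the
    -- induction hypothesis applicable.
    have hYS : marginalS Y = tensor (power ρ t) τ := by
      rw [← hcat]
      ext x y
      simp only [marginalS, hY, Matrix.submatrix_apply, g, Equiv.coe_fn_mk, Matrix.of_apply]
      simp only [tensor, Matrix.of_apply, marginalC, Finset.mul_sum, mul_comm]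
    have hYC : marginalC Y = marginalS X := by
      ext x y
      have htr := (hρ.power t).2
      simp only [Matrix.trace, Matrix.diag_apply] at htr
      simp only [marginalC, hY, Matrix.submatrix_apply, g, Equiv.coe_fn_mk, Matrix.of_apply,
        sum_joint]
      rw [Finset.sum_comm]
      simp only [tensor, Matrix.of_apply, ← Finset.mul_sum, htr, mul_one, marginalS]
    refine ⟨_, ((((IsLOCC.reindex f).comp (hΛ.ampl (Copies d t))).comp
      (IsLOCC.reindex g)).comp (hΨ.ampl e)).comp (IsLOCC.swap.comp IsLOCC.consCopy), fun i => ?_⟩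
    simp only [h1, ampl_tensor hΛ.isLinearMap]
    rw [← hX, ← hY]
    refine Fin.cases ?_ (fun i => ?_) i
    · rw [copyMarginal_zero_consCopy, marginalS_swap, marginalC_ampl hΨ, hYC]
    · rw [copyMarginal_succ_consCopy, marginalC_swap, marginalS_ampl hΨ.isLinearMap, hYS, hmarg]

theorem CatalyticallyConvertible.marginallyReducible {p₀ : Fin N} (hp₀ : ∀ q, p₀ ≤ q)
    {ρ : Op d} {σ : Op e} (hρ : IsState ρ) (hσ : IsState σ) (hdist : Distillable ρ)
    (h : CatalyticallyConvertible ρ σ) : MarginallyReducible ρ σ := by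
  intro ε hε δ hδ
  obtain ⟨c, _, _, τ, Λ, hτ, hΛ, hclose, hcat⟩ := h (ε / 2) (half_pos hε)
  obtain ⟨n, Γ, hΓ, hprep⟩ := hdist.exists_approx hp₀ hρ hτ (half_pos hε)
  -- `n` is the cost of the catalyst; `n < t * δ` gives `t / (n + t) > 1 - δ`.
  obtain ⟨t, ht⟩ := exists_nat_gt ((n : ℝ) / δ)
  obtain ⟨Ψ, hΨ, hmarg⟩ := exists_iterate_catalysis hρ hΛ hcat t
  obtain ⟨Δ, hΔ, hsplit⟩ := IsLOCC.exists_splitCopies ρ n t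
  have ht0 : (0 : ℝ) < t := lt_of_le_of_lt (by positivity) ht
  have htpos : 0 < t := by exact_mod_cast ht0
  refine ⟨t, n + t, by omega, by omega, _,
    ((hΔ.comp (hΓ.ampl (Copies d t))).comp IsLOCC.swap).comp hΨ, fun i => ?_, ?_⟩
  · rw [hsplit, ampl_tensor hΓ.isLinearMap, swap_tensor]
    have hC := hΨ.comp (IsLOCC.copyMarginal i)
    have h1 := hC.traceBound (hprep.tensor_left (hρ.power t))
    have h2 : tensor (power ρ t) (Γ (power ρ n) - τ) =
        tensor (power ρ t) (Γ (power ρ n)) - tensor (power ρ t) τ := by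
      ext x y
      simp [tensor, mul_sub]
    rw [h2, hC.isLinearMap.map_sub, hmarg i] at h1
    have h3 : TraceBound _ (marginalS (Λ (tensor ρ τ)) - σ) := TraceBound.of_traceNorm
      (((hΛ.comp (IsLOCC.marginalS _ _)).posSemidef (hρ.tensor hτ).1).1.sub hσ.1.1)
    have h4 := (h1.add h3).traceNorm_le
    rw [sub_add_sub_cancel] at h4
    linarith
  · have hpos : (0 : ℝ) < (n + t : ℕ) := by
      push_cast
      positivity
    rw [← sub_lt_iff_lt_add, lt_div_iff₀ hpos]
    rw [div_lt_iff₀ hδ] at ht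
    push_cast
    have hn : (0 : ℝ) ≤ n := Nat.cast_nonneg n
    nlinarith [mul_nonneg hδ.le hn]

end Catalytic

end QEnt

open QEnt in
theorem theorem1 {N : ℕ} (hN : 2 ≤ N) {d e : Fin N → Type}
    [∀ p, Fintype (d p)] [∀ p, DecidableEq (d p)]
    [∀ p, Fintype (e p)] [∀ p, DecidableEq (e p)]
    (ρ : Op d) (σ : Op e) (hρ : IsState ρ) (hσ : IsState σ) :
    (Distillable ρ → Distillable σ →
      (MarginallyReducible ρ σ ↔ CatalyticallyConvertible ρ σ)) ∧
    (MarginallyReducible ρ σ → CatalyticallyConvertible ρ σ) ∧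
    (Distillable ρ → CatalyticallyConvertible ρ σ → MarginallyReducible ρ σ) := by
  -- The least party acts as the sender in the teleportation.
  have hp₀ : ∀ q : Fin N, (⟨0, by omega⟩ : Fin N) ≤ q := fun q => Nat.zero_le q.1
  have h₁ : MarginallyReducible ρ σ → CatalyticallyConvertible ρ σ := fun h =>
    h.catalyticallyConvertible ⟨0, by omega⟩ hρ hσ
  have h₂ : Distillable ρ → CatalyticallyConvertible ρ σ → MarginallyReducible ρ σ :=
    fun hd h => h.marginallyReducible hp₀ hρ hσ hd
  exact ⟨fun hd _ => ⟨h₁, h₂ hd⟩, h₁, h₂⟩
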